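/- An instance of \textsc{Generalized $T$-Coloring} is a triple $(G,t,s)$, where $G=(V,E)$ is a finite graph, $t$ assigns to every edge $e\in E$ a finite set $t(e)\subseteq\mathbb{N}=\{0,1,2,\dots\}$ of forbidden distances, and $s\in\mathbb{N}$. The question is whether there is an assignment $c:V\to\{1,\dots,s\}$ with $|c(u)-c(v)|\notin t(uv)$ for every edge $uv\in E$. Let $n=|V|$, let $l=\max\bigcup_{e\in E}t(e)$ be the largest forbidden distance ($l=0$ if there is none), and let $r$ be the bit size of the instance, i.e. the number of bits of a binary encoding of $(G,t,s)$ in which every element of every set $t(e)$ is listed in binary. Algorithms are deterministic Turing machines with several stacks (equivalently, up to polynomial factors, several tapes), and time is their number of steps. The Exponential Time Hypothesis (ETH) states that there are no function $g$ with $g(n)=o(n)$ and algorithm that decides the satisfiability of $3$-CNF formulas with $n$ variables in time $2^{g(n)}$ times a polynomial in the length of the formula. Assume ETH. Then: 1. there are no function $f$ with $f(n)=o(\sqrt n)$ and algorithm solving \textsc{Generalized $T$-Coloring} in time $2^{2^{f(n)}}\,{\rm poly}(r)$; 2. there are no function $f$ with $f(l)=o\big(\log l/(\log\log l)^2\big)$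 (as $l\to\infty$) and algorithm solving \textsc{Generalized $T$-Coloring} in time $2^{n\cdot f(l)}\,{\rm poly}(r)$; 3. in particular, there is no algorithm solving \textsc{Generalized $T$-Coloring} in time $O(n!)\,{\rm poly}(r)$. -/

import Mathlib

/-! ### Binary encodings

All codes are self-delimiting bit strings, so that codes can be concatenated. -/

/-- The code of a list: every entry is preceded by the bit `1`, and a bit `0` ends the list. -/
def encodeListWith {α : Type} (e : α → List Bool) (L : List α) : List Bool :=
  L.flatMap (fun x => true :: e x) ++ [false]

/-- The self-delimiting binary code of a natural number (two bits per binary digit, plus one). -/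
def encodeNatBits (k : ℕ) : List Bool :=
  encodeListWith (fun b => [b]) k.bits

/-! ### Deciding a problem within a time bound -/

/-- Some deterministic multi-stack Turing machine (Mathlib's `Turing.FinTM2`), started on the bit
string `enc a`, halts for every instance `a` after at most `T a` steps, with the correct answer to
the question `P a` as its output bit. -/
def DecidableWithinTime {α : Type} (enc : α → List Bool) (P : α → Prop) (T : α → ℝ) : Prop :=
  ∃ M : Turing.TM2ComputableAux Bool Bool, ∀ a : α, ∃ (b : Bool) (m : ℕ),
    (b = true ↔ P a) ∧ (m : ℝ) ≤ T a ∧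
      Nonempty (Turing.TM2OutputsInTime M.tm
        ((enc a).map M.inputAlphabet.symm) (some ([b].map M.outputAlphabet.symm)) m)

/-! ### The Exponential Time Hypothesis -/

/-- A formula in conjunctive normal form over the variables `x₀, …, xₙ₋₁`, `n = numVars`, with at
most three literals in every clause. The literal `(i, true)` is `xᵢ` and `(i, false)` is its
negation. -/
structure ThreeCNF where
  numVars : ℕ
  clauses : List (List (Fin numVars × Bool))
  width_le : ∀ C ∈ clauses, C.length ≤ 3

namespace ThreeCNF

/-- Some truth assignment makes a literal of every clause true. -/
def Satisfiable (φ : ThreeCNF) : Prop :=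
  ∃ τ : Fin φ.numVars → Bool, ∀ C ∈ φ.clauses, ∃ x ∈ C, τ x.1 = x.2

/-- The binary code of a formula: the number of variables, then the list of the clauses. -/
def encode (φ : ThreeCNF) : List Bool :=
  encodeNatBits φ.numVars ++
    encodeListWith (encodeListWith fun x => x.2 :: encodeNatBits x.1) φ.clauses

end ThreeCNF

/-- The Exponential Time Hypothesis: the satisfiability of `3`-CNF formulas with `n` variables
cannot be decided in time `2 ^ o(n)`, up to a factor polynomial in the length of the formula. -/
def ExponentialTimeHypothesis : Prop :=
  ¬ ∃ (g : ℕ → ℝ) (p : Polynomial ℕ),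
    g =o[Filter.atTop] (fun n : ℕ => (n : ℝ)) ∧
      DecidableWithinTime ThreeCNF.encode ThreeCNF.Satisfiable
        (fun φ => (2 : ℝ) ^ g φ.numVars * (p.eval φ.encode.length : ℕ))

/-! ### Generalized `T`-Coloring -/

/-- An instance `(G, t, s)`: a finite graph `G`, a finite set `t e` of forbidden distances for every
edge `e`, and the number `s` of colors. -/
structure GenTColoring where
  /-- the number of vertices -/
  n : ℕ
  G : SimpleGraph (Fin n)
  t : G.edgeSet → Finset ℕ
  s : ℕ

namespace GenTColoring

/-- There is an assignment `c : V → {1, …, s}` with `|c u - c v| ∉ t(uv)` for every edge `uv`. -/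
def Positive (I : GenTColoring) : Prop :=
  ∃ c : Fin I.n → ℕ, (∀ v, c v ∈ Finset.Icc 1 I.s) ∧
    ∀ (u v : Fin I.n) (h : I.G.Adj u v), ((c u : ℤ) - (c v : ℤ)).natAbs ∉ I.t ⟨s(u, v), h⟩

open Classical in
/-- The largest forbidden distance `ℓ` of the instance (`0` if there is none), that is, the least
`ℓ` for which the instance is `ℓ`-bounded. -/
noncomputable def maxDist (I : GenTColoring) : ℕ :=
  Finset.univ.sup fun e : I.G.edgeSet => (I.t e).sup id

open Classical in
/-- The binary code of an instance: the number `n` of vertices, the number `s` of colors, and for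
each pair `i < j` of vertices, in lexicographic order, one bit that tells whether `ij` is an edge,
followed for an edge by the list of all elements of `t(ij)`. -/
noncomputable def encode (I : GenTColoring) : List Bool :=
  encodeNatBits I.n ++ encodeNatBits I.s ++
    (List.finRange I.n).flatMap fun i => (List.finRange I.n).flatMap fun j =>
      if i < j then
        if h : I.G.Adj i j then
          true :: encodeListWith encodeNatBits ((I.t ⟨s(i, j), h⟩).sort (· ≤ ·))
        else [false]
      else []

/-- The bit size `r` of an instance. -/
noncomputable def bitSize (I : GenTColoring) : ℕ := I.encode.length

/-- Some algorithm solves Generalized `T`-Coloring in time `T I * poly(r)`, where `r` is the bit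
size of the instance `I`. -/
def SolvableInTimeUpToPoly (T : GenTColoring → ℝ) : Prop :=
  ∃ p : Polynomial ℕ, DecidableWithinTime encode Positive
    (fun I => T I * (p.eval I.bitSize : ℕ))

end GenTColoring

/-! A 3-CNF formula with N variables becomes a coloring instance with only Θ(log² N) vertices but s
= 2^(3w) colors, where w ≈ N / log N. The variables are cut into g = `blocks N` ≈ log₂ N blocks of
length w = `blockLen N`, so that an assignment of a block is a number below A = 2^w. One color
stores whole blocks: the vertex of a block has a color A - a with a < A, and the vertex of an
ordered pair of blocks has a color (b + 1)A, where the two base-A digits of b are the assignments of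
the pair. The distance of these colors is a + A·b, from which all three assignments can be read off.
A set of forbidden distances can therefore impose any relation between three blocks: the consistency
of pair vertices with block vertices, and the clauses, each of which meets at most three blocks. Two
more vertices at the forced distance s - 1 fix the coloring up to a reflection. This gives
`ThreeCNF.satisfiable_iff`.

Writing down the instance takes time polynomial in the length of the formula, N and s, which is
2^o(N) times a polynomial in the length. Hence no solver whose time on these instances is at most
2^h(N) with h(N) = o(N), up to polynomial factors, exists under ETH (`not_solvableInTimeUpToPoly`).
All three bounds are of this kind, because n = Θ(log² N) and log l = Θ(N / log N): if f(n) = o(√n)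
then 2^f(n) ≤ N^o(1); in the second case n·f(l) = o(N); and n! ≤ 2^(n²) with n² = O(log⁴ N).

The reduction has to be carried out by a Turing machine. Structured programs are compiled to a
machine that afterwards continues as the solver (`Compile.outputs_machine`). The program for the
reduction is obtained from closure properties of the predicates `Comp`, `Decides` and `Emits`.
Numbers are kept in unary registers, which is affordable since time polynomial in s is allowed. -/

/-! ### A structured language for stack machines -/

/-- Structured programs acting on stacks of bits that are indexed by the natural numbers. -/
inductive Prog
  | skip
  | push (k : ℕ) (b : Bool)
  | pop (k : ℕ)
  | seq (p q : Prog)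
  | case (k : ℕ) (p q r : Prog)
  | loop (k : ℕ) (p : Prog)

namespace Prog

/-- The branch of a `case` that is selected by the top of the stack. -/
def select (p q r : Prog) : Option Bool → Prog
  | none => p
  | some true => q
  | some false => r

/-- `Exec p s s' t`: started on the stacks `s`, the program `p` ends with the stacks `s'` after `t`
steps. -/
inductive Exec : Prog → (ℕ → List Bool) → (ℕ → List Bool) → ℕ → Prop
  | skip (s) : Exec skip s s 1
  | push (k b s) : Exec (push k b) s (Function.update s k (b :: s k)) 1
  | pop (k s) : Exec (pop k) s (Function.update s k (s k).tail) 1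
  | seq {p q s s' s'' t t'} : Exec p s s' t → Exec q s' s'' t' → Exec (seq p q) s s'' (t + t' + 1)
  | case {k p q r s s' t} : Exec (select p q r (s k).head?) s s' t →
      Exec (case k p q r) s s' (t + 1)
  | loop_nil {k p s} : s k = [] → Exec (loop k p) s s 1
  | loop_cons {k p s s' s'' t t'} : s k ≠ [] → Exec p s s' t → Exec (loop k p) s' s'' t' →
      Exec (loop k p) s s'' (t + t' + 1)

/-- A bound for the indices of the stacks that a program uses. -/
def width : Prog → ℕ
  | skip => 0
  | push k _ => k + 1
  | pop k => k + 1
  | seq p q => max p.width q.width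
  | case k p q r => max (k + 1) (max p.width (max q.width r.width))
  | loop k p => max (k + 1) p.width

/-- The continuations that occur while `p` is run with the continuation `c`. -/
def conts : Prog → List Prog → List (List Prog)
  | p@(skip), c => [p :: c]
  | p@(push _ _), c => [p :: c]
  | p@(pop _), c => [p :: c]
  | P@(seq p q), c => (P :: c) :: (conts p (q :: c) ++ conts q c)
  | P@(case _ p q r), c => (P :: c) :: (conts p c ++ (conts q c ++ conts r c))
  | P@(loop _ p), c => (P :: c) :: conts p (P :: c)

theorem cons_mem_conts (p : Prog) (c : List Prog) : p :: c ∈ conts p c := by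
  cases p <;> simp [conts]

end Prog

/-! ### Compilation to a Turing machine that continues with a given one -/

/-- `n` steps of `f` lead from `a` to `b`. -/
def StepsTo {σ : Type*} (f : σ → Option σ) (n : ℕ) (a b : σ) : Prop :=
  (flip bind f)^[n] (some a) = some b

namespace StepsTo

variable {σ : Type*} {f : σ → Option σ} {a b c : σ} {m n : ℕ}

theorem trans (h₁ : StepsTo f m a b) (h₂ : StepsTo f n b c) : StepsTo f (m + n) a c := by
  unfold StepsTo at *
  rw [add_comm, Function.iterate_add_apply, h₁, h₂]

theorem single (h : f a = some b) : StepsTo f 1 a b := h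

theorem head (h : f a = some b) (h₂ : StepsTo f n b c) : StepsTo f (n + 1) a c := by
  rw [add_comm]; exact (single h).trans h₂

end StepsTo

namespace Compile

open Turing TM2

variable (M : FinTM2) (inA : M.Γ M.k₀ ≃ Bool) (w : ℕ) (L : List (List Prog))

/-- Stack alphabets of the combined machine. -/
abbrev Alph : Fin (w + 3) ⊕ M.K → Type := Sum.elim (fun _ => Bool) M.Γ

/-- Labels of the combined machine. -/
abbrev Label : Type := {c : List Prog // c ∈ L} ⊕ M.Λ

/-- Internal states of the combined machine. -/
abbrev State : Type := Option Bool × M.σ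

/-- The stack of the combined machine that carries the stack `k` of a program. -/
def toK (k : ℕ) : Fin (w + 3) ⊕ M.K := .inl (Fin.ofNat (w + 3) k)

/-- The label of a continuation. -/
noncomputable def lab (c : List Prog) : Label M L :=
  open Classical in if h : c ∈ L then .inl ⟨c, h⟩ else .inr M.main

theorem lab_of_mem {c : List Prog} (h : c ∈ L) : lab M L c = .inl ⟨c, h⟩ := by
  simp [lab, h]

/-- Push a bit to a stack of the program. -/
def pushLeft (k : ℕ) (f : State M → Bool) (q : TM2.Stmt (Alph M w) (Label M L) (State M)) :
    TM2.Stmt (Alph M w) (Label M L) (State M) :=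
  .push (toK M w k) f q

/-- Pop a bit from a stack of the program. -/
def popLeft (k : ℕ) (f : State M → Option Bool → State M)
    (q : TM2.Stmt (Alph M w) (Label M L) (State M)) : TM2.Stmt (Alph M w) (Label M L) (State M) :=
  .pop (toK M w k) f q

/-- Inspect the top of a stack of the program. -/
def peekLeft (k : ℕ) (f : State M → Option Bool → State M)
    (q : TM2.Stmt (Alph M w) (Label M L) (State M)) : TM2.Stmt (Alph M w) (Label M L) (State M) :=
  .peek (toK M w k) f q

/-- Push a symbol to a stack of `M`. -/
def pushRight (k : M.K) (f : State M → M.Γ k)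
    (q : TM2.Stmt (Alph M w) (Label M L) (State M)) : TM2.Stmt (Alph M w) (Label M L) (State M) :=
  .push (.inr k) f q

/-- Pop a symbol from a stack of `M`. -/
def popRight (k : M.K) (f : State M → Option (M.Γ k) → State M)
    (q : TM2.Stmt (Alph M w) (Label M L) (State M)) : TM2.Stmt (Alph M w) (Label M L) (State M) :=
  .pop (.inr k) f q

/-- Statements of `M` as statements of the combined machine. -/
def embed : TM2.Stmt M.Γ M.Λ M.σ → TM2.Stmt (Alph M w) (Label M L) (State M)
  | .push k f q => pushRight M w L k (fun v => f v.2) (embed q)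
  | .peek k f q => .peek (.inr k) (fun v o => (v.1, f v.2 o)) (embed q)
  | .pop k f q => popRight M w L k (fun v o => (v.1, f v.2 o)) (embed q)
  | .load f q => .load (fun v => (v.1, f v.2)) (embed q)
  | .branch f q₁ q₂ => .branch (fun v => f v.2) (embed q₁) (embed q₂)
  | .goto f => .goto (fun v => .inr (f v.2))
  | .halt => .halt

/-- The statement that carries out the first step of a continuation. The empty continuation moves
the output of the program to the input stack of `M` and starts `M`. -/
noncomputable def code : List Prog → TM2.Stmt (Alph M w) (Label M L) (State M)
  | [] => popLeft M w L 2 (fun v o => (o, v.2)) <|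
      .branch (fun v => v.1.isNone) (.goto fun _ => .inr M.main) <|
        pushRight M w L M.k₀ (fun v => inA.symm (v.1.getD false)) <|
          .load (fun v => (none, v.2)) (.goto fun _ => lab M L [])
  | .skip :: c => .goto fun _ => lab M L c
  | .push k b :: c => pushLeft M w L k (fun _ => b) (.goto fun _ => lab M L c)
  | .pop k :: c => popLeft M w L k (fun v _ => v) (.goto fun _ => lab M L c)
  | .seq p q :: c => .goto fun _ => lab M L (p :: q :: c)
  | .case k p q r :: c => peekLeft M w L k (fun v o => (o, v.2)) <|
      .branch (fun v => v.1.isNone) (.goto fun _ => lab M L (p :: c)) <|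
        .branch (fun v => v.1.getD false)
          (.load (fun v => (none, v.2)) (.goto fun _ => lab M L (q :: c)))
          (.load (fun v => (none, v.2)) (.goto fun _ => lab M L (r :: c)))
  | .loop k p :: c => peekLeft M w L k (fun v o => (o, v.2)) <|
      .branch (fun v => v.1.isNone) (.goto fun _ => lab M L c) <|
        .load (fun v => (none, v.2)) (.goto fun _ => lab M L (p :: .loop k p :: c))

/-- The statements of the combined machine. -/
noncomputable def stmts : Label M L → TM2.Stmt (Alph M w) (Label M L) (State M)
  | .inl c => code M inA w L c
  | .inr l => embed M w L (M.m l)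

/-- The stacks of the combined machine. -/
def join (s : ℕ → List Bool) (T : ∀ k, List (M.Γ k)) : ∀ k, List (Alph M w k)
  | .inl i => s i
  | .inr k => T k

theorem join_toK {k : ℕ} (hk : k < w + 3) (s : ℕ → List Bool) (T : ∀ k, List (M.Γ k)) :
    join M w s T (toK M w k) = s k :=
  congrArg s (Nat.mod_eq_of_lt hk)

theorem join_update_left {k : ℕ} (hk : k < w + 3) (s : ℕ → List Bool) (T : ∀ k, List (M.Γ k))
    (l : List Bool) :
    Function.update (join M w s T) (toK M w k) l = join M w (Function.update s k l) T := by
  have hv : ((Fin.ofNat (w + 3) k : Fin (w + 3)) : ℕ) = k := Nat.mod_eq_of_lt hk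
  funext x
  rcases x with i | j
  · by_cases h : i = Fin.ofNat (w + 3) k
    · subst h
      refine (Function.update_self (β := fun k => List (Alph M w k)) _ _ _).trans ?_
      change l = Function.update s k l ((Fin.ofNat (w + 3) k : Fin (w + 3)) : ℕ)
      rw [hv, Function.update_self]
    · have h' : (i : ℕ) ≠ k := fun h' => h (Fin.ext (h'.trans hv.symm))
      refine (Function.update_of_ne (β := fun k => List (Alph M w k))
        (fun e => h (Sum.inl.inj e)) _ _).trans ?_
      exact (Function.update_of_ne h' l s).symm
  · exact Function.update_of_ne (β := fun k => List (Alph M w k)) Sum.inr_ne_inl _ _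

theorem join_update_right (k : M.K) (s : ℕ → List Bool) (T : ∀ k, List (M.Γ k))
    (l : List (M.Γ k)) :
    Function.update (join M w s T) (.inr k) l = join M w s (Function.update T k l) := by
  funext x
  rcases x with i | j
  · exact Function.update_of_ne (β := fun k => List (Alph M w k)) Sum.inl_ne_inr _ _
  · by_cases h : j = k
    · subst h
      exact (Function.update_self (β := fun k => List (Alph M w k)) _ _ _).trans
        (Function.update_self (β := fun k => List (M.Γ k)) j l T).symm
    · exact (Function.update_of_ne (β := fun k => List (Alph M w k))
        (fun e => h (Sum.inr.inj e)) _ _).trans (Function.update_of_ne (β := fun k => List (M.Γ k)) h l T).symm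

theorem stepAux_push_left {k : ℕ} (hk : k < w + 3) (f : State M → Bool)
    (q : TM2.Stmt (Alph M w) (Label M L) (State M)) (v : State M) (s : ℕ → List Bool)
    (T : ∀ k, List (M.Γ k)) :
    TM2.stepAux (pushLeft M w L k f q) v (join M w s T) =
      TM2.stepAux q v (join M w (Function.update s k (f v :: s k)) T) := by
  rw [← join_update_left M w hk, ← join_toK M w hk s T]; rfl

theorem stepAux_pop_left {k : ℕ} (hk : k < w + 3) (f : State M → Option Bool → State M)
    (q : TM2.Stmt (Alph M w) (Label M L) (State M)) (v : State M) (s : ℕ → List Bool)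
    (T : ∀ k, List (M.Γ k)) :
    TM2.stepAux (popLeft M w L k f q) v (join M w s T) =
      TM2.stepAux q (f v (s k).head?) (join M w (Function.update s k (s k).tail) T) := by
  rw [← join_update_left M w hk, ← join_toK M w hk s T]; rfl

theorem stepAux_peek_left {k : ℕ} (hk : k < w + 3) (f : State M → Option Bool → State M)
    (q : TM2.Stmt (Alph M w) (Label M L) (State M)) (v : State M) (s : ℕ → List Bool)
    (T : ∀ k, List (M.Γ k)) :
    TM2.stepAux (peekLeft M w L k f q) v (join M w s T) =
      TM2.stepAux q (f v (s k).head?) (join M w s T) := by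
  rw [← join_toK M w hk s T]; rfl

theorem stepAux_push_right (k : M.K) (f : State M → M.Γ k)
    (q : TM2.Stmt (Alph M w) (Label M L) (State M)) (v : State M) (s : ℕ → List Bool)
    (T : ∀ k, List (M.Γ k)) :
    TM2.stepAux (pushRight M w L k f q) v (join M w s T) =
      TM2.stepAux q v (join M w s (Function.update T k (f v :: T k))) := by
  rw [← join_update_right]; rfl

theorem stepAux_pop_right (k : M.K) (f : State M → Option (M.Γ k) → State M)
    (q : TM2.Stmt (Alph M w) (Label M L) (State M)) (v : State M) (s : ℕ → List Bool)
    (T : ∀ k, List (M.Γ k)) :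
    TM2.stepAux (popRight M w L k f q) v (join M w s T) =
      TM2.stepAux q (f v (T k).head?) (join M w s (Function.update T k (T k).tail)) := by
  rw [← join_update_right]; rfl

/-- Configurations of `M` as configurations of the combined machine. -/
def embedCfg (c : TM2.Cfg M.Γ M.Λ M.σ) : TM2.Cfg (Alph M w) (Label M L) (State M) :=
  ⟨c.l.map .inr, (none, c.var), join M w (fun _ => []) c.stk⟩

theorem stepAux_embed (q : TM2.Stmt M.Γ M.Λ M.σ) (v : M.σ) (T : ∀ k, List (M.Γ k)) :
    TM2.stepAux (embed M w L q) (none, v) (join M w (fun _ => []) T) =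
      embedCfg M w L (TM2.stepAux q v T) := by
  induction q generalizing v T with
  | push k f q ih =>
    rw [embed, stepAux_push_right]
    exact ih _ _
  | peek k f q ih => exact ih _ _
  | pop k f q ih =>
    rw [embed, stepAux_pop_right]
    exact ih _ _
  | load f q ih => exact ih _ _
  | branch f q₁ q₂ ih₁ ih₂ =>
    simp only [embed, TM2.stepAux]
    cases f v
    · exact ih₂ v T
    · exact ih₁ v T
  | goto f => rfl
  | halt => rfl

theorem step_embed (c : TM2.Cfg M.Γ M.Λ M.σ) :
    TM2.step (stmts M inA w L) (embedCfg M w L c) =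
      (TM2.step M.m c).map (embedCfg M w L) := by
  rcases c with ⟨_ | l, v, T⟩
  · rfl
  · simp only [TM2.step, Option.map_some]
    exact congrArg some (stepAux_embed M w L (M.m l) v T)

theorem stepsTo_embed {n : ℕ} {c c' : TM2.Cfg M.Γ M.Λ M.σ} (h : StepsTo (TM2.step M.m) n c c') :
    StepsTo (TM2.step (stmts M inA w L)) n (embedCfg M w L c) (embedCfg M w L c') := by
  have key : ∀ (n : ℕ) (x : Option (TM2.Cfg M.Γ M.Λ M.σ)),
      (flip bind (TM2.step (stmts M inA w L)))^[n] (x.map (embedCfg M w L)) =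
        ((flip bind (TM2.step M.m))^[n] x).map (embedCfg M w L) := by
    intro n
    induction n with
    | zero => intro x; rfl
    | succ n ih =>
      intro x
      rw [Function.iterate_succ_apply, Function.iterate_succ_apply, ← ih]
      congr 1
      rcases x with _ | c
      · rfl
      · exact step_embed M inA w L c
  have := key n (some c)
  unfold StepsTo at *
  rw [h] at this
  exact this

/-- The configuration of the combined machine in which the continuation `c` is about to be run. -/
noncomputable def cfg (c : List Prog) (v : M.σ) (s : ℕ → List Bool) (T : ∀ k, List (M.Γ k)) :
    TM2.Cfg (Alph M w) (Label M L) (State M) :=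
  ⟨some (lab M L c), (none, v), join M w s T⟩

theorem step_cfg {c : List Prog} (h : c ∈ L) (v : M.σ) (s : ℕ → List Bool)
    (T : ∀ k, List (M.Γ k)) :
    TM2.step (stmts M inA w L) (cfg M w L c v s T) =
      some (TM2.stepAux (code M inA w L c) (none, v) (join M w s T)) := by
  simp only [cfg, lab_of_mem M L h, TM2.step, stmts]

/-- The labels of the machine are the continuations themselves, so each step counted by `Exec` is
one machine step and the counts agree exactly. The cell for the inspected bit is reset to `none`
within every step, which is the invariant built into `cfg`. -/
theorem stepsTo_of_exec {p : Prog} {s s' : ℕ → List Bool} {t : ℕ} (h : p.Exec s s' t)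
    (hw : p.width ≤ w + 3) (v : M.σ) (T : ∀ k, List (M.Γ k)) {c : List Prog}
    (hL : ∀ x ∈ p.conts c, x ∈ L) (hc : c ∈ L) :
    StepsTo (TM2.step (stmts M inA w L)) t (cfg M w L (p :: c) v s T) (cfg M w L c v s' T) := by
  induction h generalizing c with
  | skip s =>
    refine StepsTo.single ?_
    rw [step_cfg M inA w L (hL _ (Prog.cons_mem_conts _ _))]
    rfl
  | push k b s =>
    refine StepsTo.single ?_
    rw [step_cfg M inA w L (hL _ (Prog.cons_mem_conts _ _))]
    have hk : k < w + 3 := hw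
    rw [code, stepAux_push_left M w L hk]
    rfl
  | pop k s =>
    refine StepsTo.single ?_
    rw [step_cfg M inA w L (hL _ (Prog.cons_mem_conts _ _))]
    have hk : k < w + 3 := hw
    rw [code, stepAux_pop_left M w L hk]
    rfl
  | @seq p q s s' s'' t t' _ _ ih₁ ih₂ =>
    simp only [Prog.width, max_le_iff] at hw
    simp only [Prog.conts, List.mem_cons, List.mem_append] at hL
    have hq := hL _ (.inr (.inr (Prog.cons_mem_conts q c)))
    have h1 := ih₁ hw.1 (c := q :: c) (fun x hx => hL x (.inr (.inl hx))) hq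
    have h2 := ih₂ hw.2 (fun x hx => hL x (.inr (.inr hx))) hc
    refine StepsTo.head ?_ (h1.trans h2)
    rw [step_cfg M inA w L (hL _ (.inl rfl))]
    rfl
  | @case k p q r s s' t _ ih =>
    simp only [Prog.width, max_le_iff] at hw
    simp only [Prog.conts, List.mem_cons, List.mem_append] at hL
    have hk : k < w + 3 := hw.1
    have key : ∀ o, o = (s k).head? →
        TM2.step (stmts M inA w L) (cfg M w L (.case k p q r :: c) v s T) =
          some (cfg M w L (Prog.select p q r o :: c) v s T) := by
      intro o ho
      rw [step_cfg M inA w L (hL _ (.inl rfl))]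
      rw [code, stepAux_peek_left M w L hk, ← ho]
      rcases o with _ | _ | _ <;> rfl
    refine StepsTo.head (key _ rfl) (ih ?_ ?_ hc)
    · rcases (s k).head? with _ | _ | _ <;> simp [Prog.select, hw]
    · intro x hx
      refine hL x (.inr ?_)
      rcases h : (s k).head? with _ | _ | _ <;> simp only [h, Prog.select] at hx <;> tauto
  | @loop_nil k p s hs =>
    simp only [Prog.width, max_le_iff] at hw
    have hk : k < w + 3 := hw.1
    refine StepsTo.single ?_
    rw [step_cfg M inA w L (hL _ (Prog.cons_mem_conts _ _))]
    rw [code, stepAux_peek_left M w L hk, hs]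
    rfl
  | @loop_cons k p s s' s'' t t' hs _ _ ih₁ ih₂ =>
    simp only [Prog.width, max_le_iff] at hw
    have hk : k < w + 3 := hw.1
    have hl := hL _ (Prog.cons_mem_conts _ _)
    have hL' := hL
    simp only [Prog.conts, List.mem_cons] at hL
    have h1 := ih₁ hw.2 (c := .loop k p :: c) (fun x hx => hL x (.inr hx)) hl
    have h2 := ih₂ (by simp [Prog.width, hw]) hL' hc
    refine StepsTo.head ?_ (h1.trans h2)
    rw [step_cfg M inA w L hl]
    obtain ⟨b, l, hbl⟩ := List.exists_cons_of_ne_nil hs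
    rw [code, stepAux_peek_left M w L hk, hbl]
    rfl

/-- Popping from one stack and pushing to another reverses the string; this is why programs leave
their output reversed. The other stacks must be empty because `M` starts, and the combined machine
halts, with nothing else stored. -/
theorem stepsTo_transfer (hL : [] ∈ L) (o : List Bool) (s : ℕ → List Bool)
    (hs : ∀ k, k ≠ 2 → s k = []) (h2 : s 2 = o) (v : M.σ) (x : List Bool)
    (T : ∀ k, List (M.Γ k)) (hT : ∀ k, k ≠ M.k₀ → T k = []) (hx : T M.k₀ = x.map inA.symm) :
    StepsTo (TM2.step (stmts M inA w L)) (o.length + 1) (cfg M w L [] v s T)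
      (embedCfg M w L ⟨some M.main, v,
        Function.update (fun _ => []) M.k₀ ((o.reverse ++ x).map inA.symm)⟩) := by
  induction o generalizing s x T with
  | nil =>
    refine StepsTo.single ?_
    rw [step_cfg M inA w L hL]
    rw [code, stepAux_pop_left M w L (by omega), h2]
    have e1 : Function.update s 2 ([] : List Bool).tail = fun _ => [] := by
      funext k
      by_cases hk : k = 2
      · subst hk; simp
      · rw [Function.update_of_ne hk, hs k hk]
    have e2 : T = Function.update (fun _ => []) M.k₀ ((([] : List Bool).reverse ++ x).map inA.symm) := by
      funext k
      by_cases hk : k = M.k₀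
      · subst hk; simp [hx]
      · rw [Function.update_of_ne hk, hT k hk]
    rw [e1, ← e2]
    rfl
  | cons b o ih =>
    have := ih (Function.update s 2 o)
      (fun k hk => by rw [Function.update_of_ne hk, hs k hk]) (by simp) (b :: x)
      (Function.update T M.k₀ (inA.symm b :: T M.k₀))
      (fun k hk => by rw [Function.update_of_ne hk, hT k hk]) (by simp [hx])
    rw [List.length_cons, List.reverse_cons, List.append_assoc, List.singleton_append]
    refine StepsTo.head ?_ this
    rw [step_cfg M inA w L hL]
    rw [code, stepAux_pop_left M w L (by omega), h2]
    exact congrArg some (stepAux_push_right M w L M.k₀ (fun v => inA.symm (v.1.getD false))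
      (.load (fun v => (none, v.2)) (.goto fun _ => lab M L [])) (some b, v) _ T)

/-- The machine that runs the program `p` and then `M` on the output of `p`. -/
noncomputable def machine (p : Prog) : FinTM2 :=
  letI : Fintype {c : List Prog // c ∈ [] :: p.conts []} :=
    (List.finite_toSet ([] :: p.conts [])).fintype
  letI := M.kDecidableEq
  letI := M.kFin
  letI := M.ΛFin
  letI := M.σFin
  { K := Fin (p.width + 3) ⊕ M.K
    k₀ := .inl 0
    k₁ := .inr M.k₁
    Γ := Alph M p.width
    Λ := Label M ([] :: p.conts [])
    main := lab M _ [p]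
    σ := State M
    initialState := (none, M.initialState)
    Γk₀Fin := inferInstanceAs (Fintype Bool)
    m := stmts M inA p.width _ }

/-! ### Initial and final configurations of the combined machine. -/

theorem initList_stk_self (N : FinTM2) (x : List (N.Γ N.k₀)) : (initList N x).stk N.k₀ = x :=
  dif_pos rfl

theorem initList_stk_of_ne (N : FinTM2) (x : List (N.Γ N.k₀)) {k : N.K} (h : k ≠ N.k₀) :
    (initList N x).stk k = [] :=
  dif_neg h

theorem haltList_stk_self (N : FinTM2) (x : List (N.Γ N.k₁)) : (haltList N x).stk N.k₁ = x :=
  dif_pos rfl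

theorem haltList_stk_of_ne (N : FinTM2) (x : List (N.Γ N.k₁)) {k : N.K} (h : k ≠ N.k₁) :
    (haltList N x).stk k = [] :=
  dif_neg h

theorem initList_machine (p : Prog) (x : List Bool) :
    initList (machine M inA p) x =
      cfg M p.width ([] :: p.conts []) [p] M.initialState
        (Function.update (fun _ => []) 0 x) (fun _ => []) := by
  have : (initList (machine M inA p) x).stk =
      join M p.width (Function.update (fun _ => []) 0 x) (fun _ => []) := by
    funext k
    by_cases h : k = (.inl 0 : Fin (p.width + 3) ⊕ M.K)
    · subst h
      exact initList_stk_self (machine M inA p) x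
    · refine (initList_stk_of_ne (machine M inA p) x h).trans ?_
      rcases k with i | k
      · exact (Function.update_of_ne (fun e => h (congrArg Sum.inl (Fin.ext e))) x
          (fun _ => [])).symm
      · rfl
  exact congrArg (fun S => (⟨some (lab M _ [p]), (none, M.initialState), S⟩ :
    TM2.Cfg (Alph M p.width) (Label M ([] :: p.conts [])) (State M))) this

theorem haltList_machine (p : Prog) (y : List (M.Γ M.k₁)) :
    haltList (machine M inA p) y = embedCfg M p.width ([] :: p.conts []) (haltList M y) := by
  have : (haltList (machine M inA p) y).stk =
      join M p.width (fun _ => []) (haltList M y).stk := by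
    funext k
    rcases k with i | k
    · exact haltList_stk_of_ne (machine M inA p) y Sum.inl_ne_inr
    · by_cases h : k = M.k₁
      · subst h
        exact (haltList_stk_self (machine M inA p) y).trans (haltList_stk_self M y).symm
      · exact (haltList_stk_of_ne (machine M inA p) y (fun e => h (Sum.inr.inj e))).trans
          (haltList_stk_of_ne M y h).symm
  exact congrArg (fun S => (⟨none, (none, M.initialState), S⟩ :
    TM2.Cfg (Alph M p.width) (Label M ([] :: p.conts [])) (State M))) this

theorem initList_eq (x : List Bool) :
    initList M (x.map inA.symm) = ⟨some M.main, M.initialState,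
      Function.update (fun _ => []) M.k₀ (x.map inA.symm)⟩ := by
  have : (initList M (x.map inA.symm)).stk =
      Function.update (fun _ => []) M.k₀ (x.map inA.symm) := by
    funext k
    by_cases h : k = M.k₀
    · subst h
      exact (initList_stk_self M _).trans
        (Function.update_self (β := fun k => List (M.Γ k)) _ _ (fun _ => [])).symm
    · exact (initList_stk_of_ne M _ h).trans
        (Function.update_of_ne (β := fun k => List (M.Γ k)) h _ (fun _ => [])).symm
  rw [← this]
  rfl

/-- Three phases are concatenated: the program, the transfer of its output to the input stack of
`M`, which costs one step more than the output is long, and the run of `M`. -/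
theorem outputs_machine (p : Prog) (x x' : List Bool) (y : List (M.Γ M.k₁)) {t m : ℕ}
    (hp : p.Exec (Function.update (fun _ => []) 0 x) (Function.update (fun _ => []) 2 x'.reverse) t)
    (hM : Nonempty (TM2OutputsInTime M (x'.map inA.symm) (some y) m)) :
    Nonempty (TM2OutputsInTime (machine M inA p) x (some y) (t + (x'.length + 1) + m)) := by
  obtain ⟨⟨⟨n, hn⟩, hnm⟩⟩ := hM
  have h1 := stepsTo_of_exec M inA p.width ([] :: p.conts []) hp (by omega) M.initialState
    (fun _ => []) (c := []) (fun x hx => List.mem_cons_of_mem _ hx) List.mem_cons_self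
  have h2 := stepsTo_transfer M inA p.width ([] :: p.conts []) List.mem_cons_self x'.reverse
    (Function.update (fun _ => []) 2 x'.reverse)
    (fun k hk => Function.update_of_ne hk _ _) (Function.update_self _ _ _) M.initialState []
    (fun _ => []) (fun _ _ => rfl) rfl
  rw [List.reverse_reverse, List.append_nil, ← initList_eq, List.length_reverse] at h2
  have h3 := stepsTo_embed M inA p.width ([] :: p.conts []) (c := initList M (x'.map inA.symm))
    (c' := haltList M y) hn
  have h := (h1.trans h2).trans h3
  rw [← initList_machine, ← haltList_machine] at h
  exact ⟨⟨⟨_, h⟩, by simpa using hnm⟩⟩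

end Compile

/-- A decision procedure for a problem `Q` and a program that computes a reduction from `P` to `Q`
yield a decision procedure for `P`. -/
theorem DecidableWithinTime.of_reduction {α β : Type} {encα : α → List Bool} {encβ : β → List Bool}
    {P : α → Prop} {Q : β → Prop} {T : β → ℝ} (hQ : DecidableWithinTime encβ Q T) (f : α → β)
    (hf : ∀ a, P a ↔ Q (f a)) (p : Prog) (T' : α → ℕ)
    (hp : ∀ a, ∃ t ≤ T' a, p.Exec (Function.update (fun _ => []) 0 (encα a))
      (Function.update (fun _ => []) 2 (encβ (f a)).reverse) t) :
    DecidableWithinTime encα P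
      (fun a => (T' a + ((encβ (f a)).length + 1) : ℕ) + T (f a)) := by
  obtain ⟨M, hM⟩ := hQ
  refine ⟨⟨Compile.machine M.tm M.inputAlphabet p, Equiv.refl Bool, M.outputAlphabet⟩, fun a => ?_⟩
  obtain ⟨b, m, hb, hm, hout⟩ := hM (f a)
  obtain ⟨t, ht, hexec⟩ := hp a
  refine ⟨b, t + ((encβ (f a)).length + 1) + m, hb.trans (hf a).symm, ?_, ?_⟩
  · have : (t : ℝ) ≤ T' a := by exact_mod_cast ht
    push_cast
    linarith
  · have := Compile.outputs_machine M.tm M.inputAlphabet p (encα a) _ _ hexec hout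
    rwa [← List.map_id (encα a)] at this

/-! ### Computations with unary registers -/

/-- The stacks that hold the input `x`, the reversed output `o` and the registers `f`. -/
def regs (x o : List Bool) (f : ℕ → ℕ) : ℕ → List Bool
  | 0 => x
  | 1 => []
  | 2 => o
  | k + 3 => List.replicate (f k) true

/-- The program `p` leads from the stacks `s` to the stacks `s'` within `T` steps. -/
def Runs (p : Prog) (s s' : ℕ → List Bool) (T : ℕ) : Prop :=
  ∃ t ≤ T, p.Exec s s' t

namespace Runs

open Prog

variable {p q : Prog} {s s' s'' : ℕ → List Bool} {T T' : ℕ} {x o : List Bool} {f : ℕ → ℕ}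

theorem mono (h : Runs p s s' T) (hT : T ≤ T') : Runs p s s' T' :=
  let ⟨t, ht, he⟩ := h; ⟨t, ht.trans hT, he⟩

theorem seq (h₁ : Runs p s s' T) (h₂ : Runs q s' s'' T') :
    Runs (.seq p q) s s'' (T + T' + 1) :=
  let ⟨_, ht, he⟩ := h₁; let ⟨_, ht', he'⟩ := h₂; ⟨_, by omega, he.seq he'⟩

theorem skip (s : ℕ → List Bool) : Runs .skip s s 1 := ⟨1, le_rfl, .skip s⟩

/-- The rule for loops with a known number `n` of iterations. -/
theorem loop {k n : ℕ} (s : ℕ → ℕ → List Bool) (hn : s n k = [])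
    (hi : ∀ i < n, s i k ≠ [] ∧ Runs p (s i) (s (i + 1)) T) :
    Runs (.loop k p) (s 0) (s n) (n * (T + 1) + 1) := by
  suffices ∀ m j, j + m = n → Runs (.loop k p) (s j) (s n) (m * (T + 1) + 1) from
    this n 0 (by omega)
  intro m
  induction m with
  | zero =>
    rintro j rfl
    exact ⟨1, by omega, .loop_nil hn⟩
  | succ m ih =>
    intro j hj
    obtain ⟨h1, t, ht, he⟩ := hi j (by omega)
    obtain ⟨t', ht', he'⟩ := ih (j + 1) (by omega)
    exact ⟨_, by rw [add_mul]; omega, .loop_cons h1 he he'⟩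

theorem case_nil {k : ℕ} {r : Prog} (hk : s k = []) (h : Runs p s s' T) :
    Runs (.case k p q r) s s' (T + 1) :=
  let ⟨_, ht, he⟩ := h; ⟨_, Nat.add_le_add_right ht 1, .case (by rw [hk]; exact he)⟩

theorem case_true {k : ℕ} {r : Prog} {l : List Bool} (hk : s k = true :: l) (h : Runs q s s' T) :
    Runs (.case k p q r) s s' (T + 1) :=
  let ⟨_, ht, he⟩ := h; ⟨_, Nat.add_le_add_right ht 1, .case (by rw [hk]; exact he)⟩

theorem case_false {k : ℕ} {r : Prog} {l : List Bool} (hk : s k = false :: l) (h : Runs r s s' T) :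
    Runs (.case k p q r) s s' (T + 1) :=
  let ⟨_, ht, he⟩ := h; ⟨_, Nat.add_le_add_right ht 1, .case (by rw [hk]; exact he)⟩

theorem push (k : ℕ) (b : Bool) (s : ℕ → List Bool) :
    Runs (.push k b) s (Function.update s k (b :: s k)) 1 := ⟨1, le_rfl, .push k b s⟩

theorem pop (k : ℕ) (s : ℕ → List Bool) :
    Runs (.pop k) s (Function.update s k (s k).tail) 1 := ⟨1, le_rfl, .pop k s⟩

end Runs

theorem update_regs (x o : List Bool) (f : ℕ → ℕ) (k n : ℕ) :
    Function.update (regs x o f) (k + 3) (List.replicate n true) =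
      regs x o (Function.update f k n) := by
  funext j
  rcases j with _ | _ | _ | j
  · rfl
  · rfl
  · rfl
  · by_cases h : j = k
    · subst h; simp [regs]
    · simp [regs, Function.update_of_ne, h]

namespace Prog

/-- Increment a register. -/
def inc (k : ℕ) : Prog := .push (k + 3) true

/-- Decrement a register. -/
def dec (k : ℕ) : Prog := .pop (k + 3)

/-- Set a register to zero. -/
def clear (k : ℕ) : Prog := .loop (k + 3) (dec k)

/-- Add the register `k` to the register `j` and set it to zero. -/
def move (k j : ℕ) : Prog := .loop (k + 3) (.seq (dec k) (inc j))

/-- Add the register `k` to the register `j`, by means of the empty register `w`. -/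
def copy (k j w : ℕ) : Prog :=
  .seq (.loop (k + 3) (.seq (dec k) (.seq (inc j) (inc w)))) (move w k)

end Prog

/-! ### Basic operations on unary registers. -/

namespace Runs

open Prog Function

variable {x o : List Bool} {f : ℕ → ℕ}

theorem conv {p : Prog} {f' g g' : ℕ → ℕ} {T T' : ℕ}
    (h : Runs p (regs x o f) (regs x o f') T) (hf : ∀ r, f r = g r) (hf' : ∀ r, f' r = g' r)
    (hT : T ≤ T') : Runs p (regs x o g) (regs x o g') T' := by
  rw [← funext hf, ← funext hf']
  exact h.mono hT

theorem inc (k : ℕ) : Runs (inc k) (regs x o f) (regs x o (update f k (f k + 1))) 1 := by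
  have := Runs.push (k + 3) true (regs x o f)
  rwa [show true :: regs x o f (k + 3) = List.replicate (f k + 1) true from rfl,
    update_regs] at this

theorem dec (k : ℕ) : Runs (dec k) (regs x o f) (regs x o (update f k (f k - 1))) 1 := by
  have := Runs.pop (k + 3) (regs x o f)
  rwa [show (regs x o f (k + 3)).tail = List.replicate (f k - 1) true by simp [regs],
    update_regs] at this

theorem regs_eq_nil {k : ℕ} (h : f k = 0) : regs x o f (k + 3) = [] := by simp [regs, h]

theorem regs_ne_nil {k : ℕ} (h : f k ≠ 0) : regs x o f (k + 3) ≠ [] := by simpa [regs] using h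

theorem regs_eq_true_cons {k : ℕ} (h : f k ≠ 0) :
    regs x o f (k + 3) = true :: List.replicate (f k - 1) true := by
  obtain ⟨n, hn⟩ := Nat.exists_eq_succ_of_ne_zero h
  simp [regs, hn, List.replicate_succ]

theorem clear (k : ℕ) :
    Runs (clear k) (regs x o f) (regs x o (update f k 0)) (f k * 2 + 1) := by
  have := Runs.loop (p := Prog.dec k) (k := k + 3) (n := f k) (T := 1)
    (fun i => regs x o (update f k (f k - i))) (regs_eq_nil (by simp)) (fun i hi => ⟨?_, ?_⟩)
  · exact this.conv (by simp) (by simp) (by omega)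
  · exact regs_ne_nil (by simp; omega)
  · have := Runs.dec (x := x) (o := o) (f := update f k (f k - i)) k
    simpa [Nat.sub_sub] using this

theorem move {k j : ℕ} (hkj : k ≠ j) :
    Runs (move k j) (regs x o f) (regs x o (update (update f j (f j + f k)) k 0))
      (f k * 4 + 1) := by
  have := Runs.loop (p := .seq (Prog.dec k) (Prog.inc j)) (k := k + 3) (n := f k) (T := 3)
    (fun i => regs x o (update (update f j (f j + i)) k (f k - i)))
    (regs_eq_nil (by simp)) (fun i hi => ⟨?_, ?_⟩)
  · refine this.conv (fun r => ?_) (fun r => ?_) (by omega) <;>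
      by_cases h1 : r = k <;> by_cases h2 : r = j <;> simp_all
  · exact regs_ne_nil (by simp; omega)
  · refine (Runs.seq (Runs.dec k) (Runs.inc j)).conv (fun r => rfl) (fun r => ?_) (by omega)
    by_cases h1 : r = k <;> by_cases h2 : r = j <;>
      simp_all [Ne.symm hkj] <;> omega

theorem copy {k j w : ℕ} (hkj : k ≠ j) (hkw : k ≠ w) (hjw : j ≠ w) (hw : f w = 0) :
    Runs (copy k j w) (regs x o f) (regs x o (update f j (f j + f k))) (f k * 10 + 3) := by
  have hwk := hkw.symm
  have := Runs.loop (p := .seq (Prog.dec k) (.seq (Prog.inc j) (Prog.inc w))) (k := k + 3)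
    (n := f k) (T := 5)
    (fun i => regs x o (update (update (update f j (f j + i)) w i) k (f k - i)))
    (regs_eq_nil (by simp)) (fun i hi => ⟨?_, ?_⟩)
  · refine (this.seq (Runs.move hkw.symm)).conv (fun r => ?_) (fun r => ?_) ?_
    · by_cases h1 : r = k <;> by_cases h2 : r = j <;> by_cases h3 : r = w <;>
        simp_all
    · by_cases h1 : r = k <;> by_cases h2 : r = j <;> by_cases h3 : r = w <;>
        simp_all
    · simp [hkw.symm]; omega
  · exact regs_ne_nil (by simp; omega)
  · refine (Runs.seq (Runs.dec k) (Runs.seq (Runs.inc j) (Runs.inc w))).conv (fun r => rfl)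
      (fun r => ?_) (by omega)
    by_cases h1 : r = k <;> by_cases h2 : r = j <;> by_cases h3 : r = w <;>
      simp_all [update_apply] <;> omega

end Runs

/-- The registers `f`, where the four registers from `b` on have been set. -/
def window (f : ℕ → ℕ) (b u i y z : ℕ) (k : ℕ) : ℕ :=
  if k = b then u else if k = b + 1 then i else if k = b + 2 then y else if k = b + 3 then z else f k

namespace window

open Function

variable (f : ℕ → ℕ) (b u i y z n : ℕ)

@[simp] theorem at_zero : window f b u i y z b = u := by simp [window]
@[simp] theorem at_one : window f b u i y z (b + 1) = i := by simp [window]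
@[simp] theorem at_two : window f b u i y z (b + 2) = y := by simp [window]
@[simp] theorem at_three : window f b u i y z (b + 3) = z := by simp [window]

theorem of_lt {k : ℕ} (h : k < b) : window f b u i y z k = f k := by
  simp only [window]; split_ifs <;> omega

theorem of_gt {k : ℕ} (h : b + 3 < k) : window f b u i y z k = f k := by
  simp only [window]; split_ifs <;> omega

@[simp] theorem update_zero : update (window f b u i y z) b n = window f b n i y z := by
  funext k; simp only [window, update_apply]; split_ifs <;> omega

@[simp] theorem update_one : update (window f b u i y z) (b + 1) n = window f b u n y z := by
  funext k; simp only [window, update_apply]; split_ifs <;> omega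

@[simp] theorem update_two : update (window f b u i y z) (b + 2) n = window f b u i n z := by
  funext k; simp only [window, update_apply]; split_ifs <;> omega

@[simp] theorem update_three : update (window f b u i y z) (b + 3) n = window f b u i y n := by
  funext k; simp only [window, update_apply]; split_ifs <;> omega

variable {f b}

theorem eq_self (h : ∀ k ≥ b, f k = 0) : window f b 0 0 0 0 = f := by
  funext k; simp only [window]
  split_ifs <;> first | rfl | (subst_vars; exact (h _ (by omega)).symm)

theorem eq_update (h : ∀ k ≥ b, f k = 0) : window f b n 0 0 0 = update f b n := by
  rw [← update_zero f b 0, eq_self h]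

end window

/-- The stacks `regs x o f` with the contents `y` of the auxiliary stack. -/
def regsAux (x y o : List Bool) (f : ℕ → ℕ) : ℕ → List Bool
  | 0 => x
  | 1 => y
  | 2 => o
  | k + 3 => List.replicate (f k) true

theorem regsAux_nil (x o : List Bool) (f : ℕ → ℕ) : regsAux x [] o f = regs x o f := by
  funext k
  rcases k with _ | _ | _ | k <;> rfl

theorem update_regsAux_zero (x x' y o : List Bool) (f : ℕ → ℕ) :
    Function.update (regsAux x y o f) 0 x' = regsAux x' y o f := by
  funext k
  rcases k with _ | _ | _ | k <;> simp [regsAux]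

theorem update_regsAux_one (x y y' o : List Bool) (f : ℕ → ℕ) :
    Function.update (regsAux x y o f) 1 y' = regsAux x y' o f := by
  funext k
  rcases k with _ | _ | _ | k <;> simp [regsAux]

theorem update_regsAux_two (x y o o' : List Bool) (f : ℕ → ℕ) :
    Function.update (regsAux x y o f) 2 o' = regsAux x y o' f := by
  funext k
  rcases k with _ | _ | _ | k <;> simp [regsAux]

theorem update_regsAux (x y o : List Bool) (f : ℕ → ℕ) (k n : ℕ) :
    Function.update (regsAux x y o f) (k + 3) (List.replicate n true) =
      regsAux x y o (Function.update f k n) := by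
  funext j
  rcases j with _ | _ | _ | j
  · rfl
  · rfl
  · rfl
  · by_cases h : j = k
    · subst h; simp [regsAux]
    · simp [regsAux, Function.update_of_ne, h]

namespace Prog

/-- Move the top of the stack `k` to the stack `j`. -/
def shift (k j : ℕ) : Prog :=
  .case k .skip (.seq (.pop k) (.push j true)) (.seq (.pop k) (.push j false))

/-- Restore the input from the auxiliary stack. -/
def rewind : Prog := .loop 1 (shift 1 0)

end Prog

/-! ### Reading the input without destroying it. -/

namespace Runs

open Prog Function

variable {x y o : List Bool} {f : ℕ → ℕ}

theorem shift_forward (c : Bool) :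
    Runs (shift 0 1) (regsAux (c :: x) y o f) (regsAux x (c :: y) o f) 4 := by
  have : ∀ c, Runs (.seq (.pop 0) (.push 1 c)) (regsAux (c :: x) y o f)
      (regsAux x (c :: y) o f) 3 := by
    intro c
    have h1 := Runs.pop 0 (regsAux (c :: x) y o f)
    rw [update_regsAux_zero] at h1
    have h2 := Runs.push 1 c (regsAux x y o f)
    rw [update_regsAux_one] at h2
    exact h1.seq h2
  cases c
  · exact Runs.case_false rfl (this false)
  · exact Runs.case_true rfl (this true)

theorem shift_backward (c : Bool) :
    Runs (shift 1 0) (regsAux x (c :: y) o f) (regsAux (c :: x) y o f) 4 := by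
  have : ∀ c, Runs (.seq (.pop 1) (.push 0 c)) (regsAux x (c :: y) o f)
      (regsAux (c :: x) y o f) 3 := by
    intro c
    have h1 := Runs.pop 1 (regsAux x (c :: y) o f)
    rw [update_regsAux_one] at h1
    have h2 := Runs.push 0 c (regsAux x y o f)
    rw [update_regsAux_zero] at h2
    exact h1.seq h2
  cases c
  · exact Runs.case_false rfl (this false)
  · exact Runs.case_true rfl (this true)

theorem shift_nil : Runs (shift 0 1) (regsAux [] y o f) (regsAux [] y o f) 4 :=
  (Runs.case_nil rfl (Runs.skip _)).mono (by omega)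

theorem rewind (x y o : List Bool) (f : ℕ → ℕ) :
    Runs rewind (regsAux x y o f) (regs (y.reverse ++ x) o f) (y.length * 5 + 1) := by
  have := Runs.loop (p := shift 1 0) (k := 1) (n := y.length) (T := 4)
    (fun i => regsAux ((y.take i).reverse ++ x) (y.drop i) o f) (by simp [regsAux])
    (fun i hi => ⟨by simpa [regsAux] using hi, ?_⟩)
  · simpa [regsAux_nil, Prog.rewind] using this
  · rw [List.drop_eq_getElem_cons hi, List.take_add_one, List.getElem?_eq_getElem hi,
      Option.toList_some, List.reverse_append, List.reverse_singleton, List.singleton_append]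
    exact Runs.shift_backward _

/-- Shift at most `f k` bits of the input to the auxiliary stack. -/
theorem advance (k : ℕ) :
    Runs (.loop (k + 3) (.seq (Prog.dec k) (shift 0 1))) (regs x o f)
      (regsAux (x.drop (f k)) (x.take (f k)).reverse o (update f k 0)) (f k * 7 + 1) := by
  have := Runs.loop (p := .seq (Prog.dec k) (shift 0 1)) (k := k + 3) (n := f k) (T := 6)
    (fun i => regsAux (x.drop i) (x.take i).reverse o (update f k (f k - i)))
    (by simp [regsAux]) (fun i hi => ⟨by simp [regsAux]; omega, ?_⟩)
  · simpa [regsAux_nil] using this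
  · have h1 := Runs.pop (k + 3) (regsAux (x.drop i) (x.take i).reverse o (update f k (f k - i)))
    rw [show (regsAux (x.drop i) (x.take i).reverse o (update f k (f k - i)) (k + 3)).tail =
      List.replicate (f k - i - 1) true by simp [regsAux], update_regsAux, update_idem,
      Nat.sub_sub] at h1
    refine (h1.seq (T' := 4) ?_).mono (by omega)
    by_cases hx : i < x.length
    · rw [List.drop_eq_getElem_cons hx, List.take_add_one, List.getElem?_eq_getElem hx,
        Option.toList_some, List.reverse_append, List.reverse_singleton, List.singleton_append]
      exact Runs.shift_forward _
    -- Beyond the end of the input a shift does nothing, and neither `take` nor `drop` changes any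
    -- more.
    · rw [List.drop_eq_nil_of_le (by omega), List.drop_eq_nil_of_le (by omega),
        List.take_of_length_le (by omega), List.take_of_length_le (by omega)]
      exact Runs.shift_nil

/-- Count the bits of the input. -/
theorem count (k : ℕ) :
    Runs (.loop 0 (.seq (shift 0 1) (Prog.inc k))) (regs x o f)
      (regsAux [] x.reverse o (update f k (f k + x.length))) (x.length * 7 + 1) := by
  have := Runs.loop (p := .seq (shift 0 1) (Prog.inc k)) (k := 0) (n := x.length) (T := 6)
    (fun i => regsAux (x.drop i) (x.take i).reverse o (update f k (f k + i)))
    (by simp [regsAux]) (fun i hi => ⟨by simpa [regsAux] using hi, ?_⟩)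
  · simpa [regsAux_nil] using this
  · have h1 := Runs.push (k + 3) true
      (regsAux (x.drop (i + 1)) (x.take (i + 1)).reverse o (update f k (f k + i)))
    rw [show true :: regsAux (x.drop (i + 1)) (x.take (i + 1)).reverse o
      (update f k (f k + i)) (k + 3) = List.replicate (f k + (i + 1)) true by
        simp [regsAux, ← List.replicate_succ, add_assoc], update_regsAux, update_idem] at h1
    refine (Runs.seq (T := 4) ?_ h1).mono (by omega)
    rw [List.drop_eq_getElem_cons hi, List.take_add_one, List.getElem?_eq_getElem hi,
      Option.toList_some, List.reverse_append, List.reverse_singleton, List.singleton_append]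
    exact Runs.shift_forward _

end Runs

/-! ### Functions computed by programs -/

section Computability

variable {α β : Type}

/-- The function `e` is bounded by a power of `S + 2`. -/
def Bdd (S e : α → ℕ) : Prop := ∃ c, ∀ a, e a ≤ (S a + 2) ^ c

namespace Bdd

variable {S e e' : α → ℕ}

theorem mono (h : Bdd S e') (he : ∀ a, e a ≤ e' a) : Bdd S e :=
  let ⟨c, hc⟩ := h; ⟨c, fun a => (he a).trans (hc a)⟩

theorem self (S : α → ℕ) : Bdd S S := ⟨1, fun a => by simp⟩

theorem const (n : ℕ) : Bdd S (fun _ => n) :=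
  ⟨n, fun a => n.lt_two_pow_self.le.trans (Nat.pow_le_pow_left (by omega) n)⟩

theorem mul (h : Bdd S e) (h' : Bdd S e') : Bdd S (fun a => e a * e' a) :=
  let ⟨c, hc⟩ := h; let ⟨c', hc'⟩ := h'
  ⟨c + c', fun a => by rw [pow_add]; exact Nat.mul_le_mul (hc a) (hc' a)⟩

/-- The base S + 2 is at least 2, so the factor 2 of a sum of two powers is absorbed by one more
power. -/
theorem add (h : Bdd S e) (h' : Bdd S e') : Bdd S (fun a => e a + e' a) := by
  obtain ⟨c, hc⟩ := h
  obtain ⟨c', hc'⟩ := h'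
  refine ⟨c + c' + 1, fun a => ?_⟩
  have h1 : (S a + 2) ^ c ≤ (S a + 2) ^ (c + c') := Nat.pow_le_pow_right (by omega) (by omega)
  have h2 : (S a + 2) ^ c' ≤ (S a + 2) ^ (c + c') := Nat.pow_le_pow_right (by omega) (by omega)
  have h3 : 2 * (S a + 2) ^ (c + c') ≤ (S a + 2) ^ (c + c' + 1) := by
    rw [pow_succ, mul_comm]; exact Nat.mul_le_mul le_rfl (by omega)
  have := hc a
  have := hc' a
  change e a + e' a ≤ _
  omega

theorem comp (h : Bdd S e) (π : β → α) : Bdd (fun b => S (π b)) (fun b => e (π b)) :=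
  let ⟨c, hc⟩ := h; ⟨c, fun b => hc (π b)⟩

end Bdd

/-- The function `e` can be computed, in time polynomial in `S`, from the input `inp` and from
registers that hold the values of the functions in `ρ`. The registers from `b` on are free, and `R`
describes the contents of the registers below `b`. -/
def Comp (inp : α → List Bool) (S : α → ℕ) (ρ : Set (α → ℕ)) (e : α → ℕ) : Prop :=
  Bdd S e ∧ ∀ (b : ℕ) (R : α → (ℕ → ℕ) → Prop), (∀ g ∈ ρ, ∃ k < b, ∀ a f, R a f → f k = g a) →
    ∃ (p : Prog) (T : α → ℕ), Bdd S T ∧ ∀ a f o, R a f → (∀ k ≥ b, f k = 0) →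
      Runs p (regs (inp a) o f) (regs (inp a) o (Function.update f b (e a))) (T a)

/-- The bit string `w` can be written to the output, in time polynomial in `S`, from the input `inp`
and from registers that hold the values of the functions in `ρ`. -/
def Emits (inp : α → List Bool) (S : α → ℕ) (ρ : Set (α → ℕ)) (w : α → List Bool) : Prop :=
  ∀ (b : ℕ) (R : α → (ℕ → ℕ) → Prop), (∀ g ∈ ρ, ∃ k < b, ∀ a f, R a f → f k = g a) →
    ∃ (p : Prog) (T : α → ℕ), Bdd S T ∧ ∀ a f o, R a f → (∀ k ≥ b, f k = 0) →
      Runs p (regs (inp a) o f) (regs (inp a) ((w a).reverse ++ o) f) (T a)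

variable {inp : α → List Bool} {S : α → ℕ} {ρ : Set (α → ℕ)} {e : α → ℕ}

/-- Functions on `α` as functions of the pairs of an `a : α` and a number below `n a`. -/
def liftVars (n : α → ℕ) (ρ : Set (α → ℕ)) : Set ((Σ a, Fin (n a)) → ℕ) :=
  (fun g x => g x.1) '' ρ

/-! ### Closure properties of computable functions. -/

namespace Comp

open Function

theorem bdd (h : Comp inp S ρ e) : Bdd S e := h.1

theorem var (he : e ∈ ρ) (hb : Bdd S e) : Comp inp S ρ e := by
  refine ⟨hb, fun b R hR => ?_⟩
  obtain ⟨k, hk, hkR⟩ := hR e he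
  refine ⟨.copy k b (b + 1), fun a => e a * 10 + 3, (hb.mul (.const _)).add (.const _),
    fun a f o hf h0 => ?_⟩
  have := Runs.copy (x := inp a) (o := o) (f := f) (k := k) (j := b) (w := b + 1) (by omega)
    (by omega) (by omega) (h0 _ (by omega))
  rwa [hkR a f hf, h0 b le_rfl, zero_add] at this

theorem zero : Comp inp S ρ (fun _ => 0) := by
  refine ⟨.const 0, fun b R _ => ⟨.skip, fun _ => 1, .const 1, fun a f o _ h0 => ?_⟩⟩
  exact (Runs.skip _).conv (fun _ => rfl)
    (fun r => by by_cases h : r = b <;> simp_all) le_rfl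

theorem succ (h : Comp inp S ρ e) : Comp inp S ρ (fun a => e a + 1) := by
  refine ⟨h.bdd.add (.const 1), fun b R hR => ?_⟩
  obtain ⟨p, T, hT, hp⟩ := h.2 b R hR
  refine ⟨.seq p (.inc b), fun a => T a + 1 + 1, (hT.add (.const 1)).add (.const 1),
    fun a f o hf h0 => ((hp a f o hf h0).seq (Runs.inc b)).conv (fun _ => rfl) (fun r => ?_) le_rfl⟩
  by_cases h : r = b <;> simp_all

theorem const (n : ℕ) : Comp inp S ρ (fun _ => n) := by
  induction n with
  | zero => exact zero
  | succ n ih => exact ih.succ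

/-- Computability is preserved under substitution. -/
theorem comp (h : Comp inp S ρ e) (π : β → α) {ρ' : Set (β → ℕ)}
    (hρ : ∀ g ∈ ρ, (fun x => g (π x)) ∈ ρ') :
    Comp (fun x => inp (π x)) (fun x => S (π x)) ρ' (fun x => e (π x)) := by
  refine ⟨h.bdd.comp π, fun b R hR => ?_⟩
  -- The register relation is pushed forward along `π`: a register that holds g (π x) for every x
  -- holds g a for every a that occurs.
  obtain ⟨p, T, hT, hp⟩ := h.2 b (fun a f => ∃ x, π x = a ∧ R x f) (fun g hg => by
    obtain ⟨k, hk, hkR⟩ := hR _ (hρ g hg)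
    exact ⟨k, hk, fun a f ⟨x, hx, hxf⟩ => hx ▸ hkR x f hxf⟩)
  exact ⟨p, fun x => T (π x), hT.comp π, fun x f o hf h0 => hp (π x) f o ⟨x, rfl, hf⟩ h0⟩

theorem lift (h : Comp inp S ρ e) (n : α → ℕ) {ρ' : Set ((Σ a, Fin (n a)) → ℕ)}
    (hρ : liftVars n ρ ⊆ ρ') :
    Comp (fun x : Σ a, Fin (n a) => inp x.1) (fun x => S x.1) ρ' (fun x => e x.1) :=
  h.comp Sigma.fst fun g hg => hρ ⟨g, hg, rfl⟩

/-- Computability of functions that are defined by recursion. -/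
theorem fold {n : α → ℕ} {A : α → ℕ → ℕ} (hn : Comp inp S ρ n)
    (hA : ∃ c, ∀ a, ∀ i ≤ n a, A a i ≤ (S a + 2) ^ c) (h0 : Comp inp S ρ (fun a => A a 0))
    (hs : Comp (fun x : Σ a, Fin (n a) => inp x.1) (fun x => S x.1)
      (insert (fun x => (x.2 : ℕ)) (insert (fun x => A x.1 x.2) (liftVars n ρ)))
      (fun x => A x.1 (x.2 + 1))) :
    Comp inp S ρ (fun a => A a (n a)) := by
  obtain ⟨cA, hcA⟩ := hA
  have hbA : Bdd S (fun a => (S a + 2) ^ cA) := ⟨cA, fun a => le_rfl⟩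
  refine ⟨⟨cA, fun a => hcA a _ le_rfl⟩, fun b R hR => ?_⟩
  obtain ⟨pn, Tn, hTn, hpn⟩ := hn.2 b R hR
  -- Register layout: `b` counts the remaining rounds, `b + 1` holds the index, `b + 2` the current
  -- value and `b + 3` the next value. The registers below `b` keep the contents `f₀`, which is all
  -- that the subprograms need to find their variables.
  obtain ⟨p0, T0, hT0, hp0⟩ := h0.2 (b + 2)
    (fun a f => ∃ f₀, R a f₀ ∧ ∀ k < b, f k = f₀ k) (fun g hg => by
      obtain ⟨k, hk, hkR⟩ := hR g hg
      exact ⟨k, by omega, fun a f ⟨f₀, hf₀, hf⟩ => by rw [hf k hk, hkR a f₀ hf₀]⟩)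
  obtain ⟨ps, Ts, ⟨cs, hTs⟩, hps⟩ := hs.2 (b + 3)
    (fun x f => (∃ f₀, R x.1 f₀ ∧ ∀ k < b, f k = f₀ k) ∧ f (b + 1) = x.2 ∧
      f (b + 2) = A x.1 x.2) (by
      rintro g (rfl | rfl | ⟨g, hg, rfl⟩)
      · exact ⟨b + 1, by omega, fun a f hf => hf.2.1⟩
      · exact ⟨b + 2, by omega, fun a f hf => hf.2.2⟩
      · obtain ⟨k, hk, hkR⟩ := hR g hg
        exact ⟨k, by omega, fun a f ⟨⟨f₀, hf₀, hf⟩, _⟩ => by rw [hf k hk, hkR _ f₀ hf₀]⟩)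
  have hbs : Bdd S (fun a => (S a + 2) ^ cs) := ⟨cs, fun a => le_rfl⟩
  let body : Prog := .seq (.dec b) (.seq ps (.seq (.clear (b + 2)) (.seq (.move (b + 3) (b + 2))
    (.inc (b + 1)))))
  let N : α → ℕ := fun a => (S a + 2) ^ cs + (S a + 2) ^ cA * 2 + (S a + 2) ^ cA * 4 + 8
  refine ⟨.seq pn (.seq p0 (.seq (.loop (b + 3) body) (.seq (.clear (b + 1))
    (.move (b + 2) b)))), fun a => Tn a + (T0 a + (n a * (N a + 1) + 1 + (n a * 2 + 1 +
      ((S a + 2) ^ cA * 4 + 1) + 1) + 1) + 1) + 1, ?_, fun a f o hf hz => ?_⟩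
  · have hN : Bdd S N :=
      ((hbs.add (hbA.mul (.const 2))).add (hbA.mul (.const 4))).add (.const 8)
    exact (hTn.add ((hT0.add ((((hn.bdd.mul (hN.add (.const 1))).add (.const 1)).add
      ((((hn.bdd.mul (.const 2)).add (.const 1)).add
      ((hbA.mul (.const 4)).add (.const 1))).add (.const 1))).add (.const 1))).add
      (.const 1))).add (.const 1)
  have h1 := hpn a f o hf hz
  rw [← window.eq_update _ hz] at h1
  have h2 := hp0 a (window f b (n a) 0 0 0) o ⟨f, hf, fun k hk => window.of_lt _ _ _ _ _ _ hk⟩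
    (fun k hk => by
      obtain rfl | rfl | h : k = b + 2 ∨ k = b + 3 ∨ b + 3 < k := by omega
      · simp
      · simp
      · rw [window.of_gt _ _ _ _ _ _ h, hz k (by omega)])
  rw [window.update_two] at h2
  have h3 : Runs (.loop (b + 3) body) (regs (inp a) o (window f b (n a) 0 (A a 0) 0))
      (regs (inp a) o (window f b 0 (n a) (A a (n a)) 0)) (n a * (N a + 1) + 1) := by
    have := Runs.loop (p := body) (k := b + 3) (n := n a) (T := N a)
      (fun i => regs (inp a) o (window f b (n a - i) i (A a i) 0))
      (Runs.regs_eq_nil (by simp)) (fun i hi => ⟨Runs.regs_ne_nil (by simp; omega), ?_⟩)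
    · simpa using this
    have hb := hps ⟨a, ⟨i, hi⟩⟩ (window f b (n a - (i + 1)) i (A a i) 0) o
      ⟨⟨f, hf, fun k hk => window.of_lt _ _ _ _ _ _ hk⟩, by simp, by simp⟩
      (fun k hk => by
        obtain rfl | h : k = b + 3 ∨ b + 3 < k := by omega
        · simp
        · rw [window.of_gt _ _ _ _ _ _ h, hz k (by omega)])
    have hd := Runs.dec (x := inp a) (o := o) (f := window f b (n a - i) i (A a i) 0) b
    rw [window.at_zero, window.update_zero, Nat.sub_sub] at hd
    rw [window.update_three] at hb
    have hc := Runs.clear (x := inp a) (o := o)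
      (f := window f b (n a - (i + 1)) i (A a i) (A a (i + 1))) (b + 2)
    rw [window.update_two, window.at_two] at hc
    have hm := Runs.move (x := inp a) (o := o)
      (f := window f b (n a - (i + 1)) i 0 (A a (i + 1))) (k := b + 3) (j := b + 2) (by omega)
    rw [window.at_two, window.at_three, window.update_two, window.update_three, zero_add] at hm
    have hi' := Runs.inc (x := inp a) (o := o)
      (f := window f b (n a - (i + 1)) i (A a (i + 1)) 0) (b + 1)
    rw [window.at_one, window.update_one] at hi'
    refine (hd.seq (hb.seq (hc.seq (hm.seq hi')))).mono ?_
    have e1 : Ts ⟨a, ⟨i, hi⟩⟩ ≤ (S a + 2) ^ cs := hTs ⟨a, ⟨i, hi⟩⟩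
    have e2 := hcA a i hi.le
    have e3 := hcA a (i + 1) hi
    simp only [N]
    omega
  have hc := Runs.clear (x := inp a) (o := o) (f := window f b 0 (n a) (A a (n a)) 0) (b + 1)
  rw [window.update_one, window.at_one] at hc
  have hm := Runs.move (x := inp a) (o := o)
      (f := window f b 0 0 (A a (n a)) 0) (k := b + 2) (j := b) (by omega)
  rw [window.at_two, window.at_zero, window.update_zero, window.update_two, zero_add,
    window.eq_update _ hz] at hm
  refine (h1.seq (h2.seq (h3.seq (hc.seq hm)))).mono ?_
  have e2 := hcA a (n a) le_rfl
  dsimp only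
  omega

theorem length (h : Bdd S fun a => (inp a).length) : Comp inp S ρ (fun a => (inp a).length) := by
  refine ⟨h, fun b R hR => ⟨.seq (.loop 0 (.seq (.shift 0 1) (.inc b))) .rewind,
    fun a => (inp a).length * 7 + 1 + ((inp a).length * 5 + 1) + 1,
    ((((h.mul (.const 7)).add (.const 1)).add ((h.mul (.const 5)).add (.const 1))).add (.const 1)),
    fun a f o _ hz => ?_⟩⟩
  have h1 := Runs.count (x := inp a) (o := o) (f := f) b
  rw [hz b le_rfl, zero_add] at h1
  have := h1.seq (Runs.rewind _ _ _ _)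
  simpa using this

/-- Random access to the input. -/
theorem bit (hl : Bdd S fun a => (inp a).length) (he : Comp inp S ρ e) :
    Comp inp S ρ (fun a => ((inp a)[e a]?.getD false).toNat) := by
  refine ⟨(Bdd.const 1).mono fun a => Bool.toNat_le _, fun b R hR => ?_⟩
  obtain ⟨p, T, hT, hp⟩ := he.2 b R hR
  -- After `e a` shifts the wanted bit is on top of the input. A missing bit and the bit `false`
  -- both leave the register at 0; the rewinding restores the input.
  refine ⟨.seq p (.seq (.loop (b + 3) (.seq (.dec b) (.shift 0 1)))
    (.seq (.case 0 .skip (.inc b) .skip) .rewind)),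
    fun a => T a + (e a * 7 + 1 + (1 + 1 + ((inp a).length * 5 + 1) + 1) + 1) + 1,
    (hT.add ((((he.bdd.mul (.const 7)).add (.const 1)).add (((Bdd.const (1 + 1)).add
      ((hl.mul (.const 5)).add (.const 1))).add (.const 1))).add (.const 1))).add (.const 1),
    fun a f o hf hz => ?_⟩
  have h1 := hp a f o hf hz
  have h2 := Runs.advance (x := inp a) (o := o) (f := update f b (e a)) b
  rw [update_self, update_idem] at h2
  have h3 : Runs (.case 0 .skip (.inc b) .skip)
      (regsAux ((inp a).drop (e a)) ((inp a).take (e a)).reverse o (update f b 0))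
      (regsAux ((inp a).drop (e a)) ((inp a).take (e a)).reverse o
        (update f b ((inp a)[e a]?.getD false).toNat)) (1 + 1) := by
    rw [← List.head?_drop]
    rcases h : (inp a).drop (e a) with _ | ⟨_ | _, l⟩
    · exact Runs.case_nil rfl (Runs.skip _)
    · exact Runs.case_false rfl (Runs.skip _)
    · refine Runs.case_true rfl ?_
      have := Runs.push (b + 3) true
        (regsAux (true :: l) ((inp a).take (e a)).reverse o (update f b 0))
      rwa [show true :: regsAux (true :: l) ((inp a).take (e a)).reverse o (update f b 0) (b + 3) =
        List.replicate 1 true by simp [regsAux], update_regsAux, update_idem] at this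
  refine (h1.seq (h2.seq (h3.seq ((Runs.rewind _ _ _ _).mono (T' := (inp a).length * 5 + 1)
    (by simp))))).mono le_rfl |> cast ?_
  simp

end Comp

namespace Emits

open Function

theorem nil : Emits inp S ρ (fun _ => []) :=
  fun _ _ _ => ⟨.skip, fun _ => 1, .const 1, fun _ _ _ _ _ => Runs.skip _⟩

theorem append {w w' : α → List Bool} (h : Emits inp S ρ w) (h' : Emits inp S ρ w') :
    Emits inp S ρ (fun a => w a ++ w' a) := by
  intro b R hR
  obtain ⟨p, T, hT, hp⟩ := h b R hR
  obtain ⟨p', T', hT', hp'⟩ := h' b R hR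
  refine ⟨.seq p p', fun a => T a + T' a + 1, (hT.add hT').add (.const 1), fun a f o hf hz => ?_⟩
  have := (hp a f o hf hz).seq (hp' a f _ hf hz)
  simpa using this

theorem singleton (c : Bool) : Emits inp S ρ (fun _ => [c]) := by
  refine fun _ _ _ => ⟨.push 2 c, fun _ => 1, .const 1, fun a f o _ _ => ?_⟩
  have := Runs.push 2 c (regsAux (inp a) [] o f)
  rw [update_regsAux_two, regsAux_nil, regsAux_nil] at this
  exact this

theorem cons (c : Bool) {w : α → List Bool} (h : Emits inp S ρ w) :
    Emits inp S ρ (fun a => c :: w a) :=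
  (singleton c).append h

theorem ite {w w' : α → List Bool} (he : Comp inp S ρ e) (h : Emits inp S ρ w)
    (h' : Emits inp S ρ w') : Emits inp S ρ (fun a => if e a ≠ 0 then w a else w' a) := by
  intro b R hR
  obtain ⟨pe, Te, hTe, hpe⟩ := he.2 b R hR
  obtain ⟨p, T, hT, hp⟩ := h b R hR
  obtain ⟨p', T', hT', hp'⟩ := h' b R hR
  -- A register holds only `true` bits, so the last branch is never entered. Clearing `b` before `p`
  -- restores the requirement that the registers from `b` on are zero.
  refine ⟨.seq pe (.case (b + 3) p' (.seq (.clear b) p) .skip),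
    fun a => Te a + (e a * 2 + 1 + T a + 1 + T' a + 1) + 1,
    (hTe.add ((((((he.bdd.mul (.const 2)).add (.const 1)).add hT).add (.const 1)).add hT').add
      (.const 1))).add (.const 1), fun a f o hf hz => ?_⟩
  refine (hpe a f o hf hz).seq ?_
  dsimp only
  have hb : f b = 0 := hz b le_rfl
  by_cases h0 : e a = 0
  · have := hp' a f o hf hz
    rw [if_neg (by simpa using h0), h0, ← hb, update_eq_self]
    exact (Runs.case_nil (Runs.regs_eq_nil hb) this).mono (by omega)
  · rw [if_pos h0]
    refine (Runs.case_true (Runs.regs_eq_true_cons (by simpa using h0))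
      ((Runs.clear b).seq (T' := T a) (s'' := regs (inp a) ((w a).reverse ++ o) f) ?_)).mono
        (by simp)
    rw [update_idem, ← hb, update_eq_self]
    exact hp a f o hf hz

theorem flatMap {n : α → ℕ} {w : α → ℕ → List Bool} (hn : Comp inp S ρ n)
    (hw : Emits (fun x : Σ a, Fin (n a) => inp x.1) (fun x => S x.1)
      (insert (fun x => (x.2 : ℕ)) (liftVars n ρ)) (fun x => w x.1 x.2)) :
    Emits inp S ρ (fun a => (List.range (n a)).flatMap (w a)) := by
  intro b R hR
  obtain ⟨pn, Tn, hTn, hpn⟩ := hn.2 b R hR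
  obtain ⟨ps, Ts, ⟨cs, hTs⟩, hps⟩ := hw (b + 2)
    (fun x f => (∃ f₀, R x.1 f₀ ∧ ∀ k < b, f k = f₀ k) ∧ f (b + 1) = x.2) (by
      rintro g (rfl | ⟨g, hg, rfl⟩)
      · exact ⟨b + 1, by omega, fun a f hf => hf.2⟩
      · obtain ⟨k, hk, hkR⟩ := hR g hg
        exact ⟨k, by omega, fun a f ⟨⟨f₀, hf₀, hf⟩, _⟩ => by rw [hf k hk, hkR _ f₀ hf₀]⟩)
  have hbs : Bdd S (fun a => (S a + 2) ^ cs) := ⟨cs, fun a => le_rfl⟩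
  let body : Prog := .seq (.dec b) (.seq ps (.inc (b + 1)))
  let N : α → ℕ := fun a => (S a + 2) ^ cs + 4
  refine ⟨.seq pn (.seq (.loop (b + 3) body) (.clear (b + 1))),
    fun a => Tn a + (n a * (N a + 1) + 1 + (n a * 2 + 1) + 1) + 1, ?_, fun a f o hf hz => ?_⟩
  · exact (hTn.add ((((hn.bdd.mul ((hbs.add (.const 4)).add (.const 1))).add (.const 1)).add
      ((hn.bdd.mul (.const 2)).add (.const 1))).add (.const 1))).add (.const 1)
  have h1 := hpn a f o hf hz
  rw [← window.eq_update _ hz] at h1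
  have h3 : Runs (.loop (b + 3) body) (regs (inp a) o (window f b (n a) 0 0 0))
      (regs (inp a) (((List.range (n a)).flatMap (w a)).reverse ++ o) (window f b 0 (n a) 0 0))
      (n a * (N a + 1) + 1) := by
    have := Runs.loop (p := body) (k := b + 3) (n := n a) (T := N a)
      (fun i => regs (inp a) (((List.range i).flatMap (w a)).reverse ++ o)
        (window f b (n a - i) i 0 0))
      (Runs.regs_eq_nil (by simp)) (fun i hi => ⟨Runs.regs_ne_nil (by simp; omega), ?_⟩)
    · simpa using this
    have hb := hps ⟨a, ⟨i, hi⟩⟩ (window f b (n a - (i + 1)) i 0 0)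
      (((List.range i).flatMap (w a)).reverse ++ o)
      ⟨⟨f, hf, fun k hk => window.of_lt _ _ _ _ _ _ hk⟩, by simp⟩
      (fun k hk => by
        obtain rfl | rfl | h : k = b + 2 ∨ k = b + 3 ∨ b + 3 < k := by omega
        · simp
        · simp
        · rw [window.of_gt _ _ _ _ _ _ h, hz k (by omega)])
    have hd := Runs.dec (x := inp a) (o := ((List.range i).flatMap (w a)).reverse ++ o)
      (f := window f b (n a - i) i 0 0) b
    rw [window.at_zero, window.update_zero, Nat.sub_sub] at hd
    have hi' := Runs.inc (x := inp a) (o := ((List.range (i + 1)).flatMap (w a)).reverse ++ o)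
      (f := window f b (n a - (i + 1)) i 0 0) (b + 1)
    rw [window.at_one, window.update_one] at hi'
    -- The output is stored in reverse, so a new word goes in front of the old ones.
    have ho : ((List.range (i + 1)).flatMap (w a)).reverse ++ o =
        (w a i).reverse ++ (((List.range i).flatMap (w a)).reverse ++ o) := by
      simp [List.range_succ]
    rw [ho] at hi' ⊢
    refine (hd.seq (hb.seq hi')).mono ?_
    have e1 : Ts ⟨a, ⟨i, hi⟩⟩ ≤ (S a + 2) ^ cs := hTs ⟨a, ⟨i, hi⟩⟩
    simp only [N]
    omega
  have hc := Runs.clear (x := inp a) (o := ((List.range (n a)).flatMap (w a)).reverse ++ o)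
    (f := window f b 0 (n a) 0 0) (b + 1)
  rw [window.update_one, window.at_one, window.eq_self hz] at hc
  exact h1.seq (h3.seq hc)

end Emits

end Computability

/-! ### Arithmetic -/

section Arithmetic

variable {α : Type} {inp : α → List Bool} {S : α → ℕ} {ρ : Set (α → ℕ)} {e e' : α → ℕ}
  {p q : α → Prop}

namespace Comp

theorem congr (h : Comp inp S ρ e) (he : ∀ a, e a = e' a) : Comp inp S ρ e' :=
  funext he ▸ h

/-- Definition by recursion, where the step is computed from the index, the previous value and
everything that could be computed before. -/
theorem recursion {n : α → ℕ} {A : α → ℕ → ℕ} (hn : Comp inp S ρ n)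
    (hA : ∃ B : α → ℕ, Bdd S B ∧ ∀ a, ∀ i ≤ n a, A a i ≤ B a) (h0 : Comp inp S ρ (fun a => A a 0))
    (hs : ∀ ρ' : Set ((Σ a, Fin (n a)) → ℕ), liftVars n ρ ⊆ ρ' →
      Comp (fun x => inp x.1) (fun x => S x.1) ρ' (fun x => x.2) →
      Comp (fun x => inp x.1) (fun x => S x.1) ρ' (fun x => A x.1 x.2) →
      Comp (fun x => inp x.1) (fun x => S x.1) ρ' (fun x => A x.1 (x.2 + 1))) :
    Comp inp S ρ (fun a => A a (n a)) := by
  obtain ⟨B, ⟨c, hc⟩, hB⟩ := hA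
  refine fold hn ⟨c, fun a i hi => (hB a i hi).trans (hc a)⟩ h0 (hs _ ?_ (var ?_ ?_) (var ?_ ?_))
  · exact fun g hg => .inr (.inr hg)
  · exact .inl rfl
  · exact (hn.bdd.comp Sigma.fst).mono fun x => x.2.2.le
  · exact .inr (.inl rfl)
  · exact ⟨c, fun x => (hB x.1 x.2 x.2.2.le).trans (hc x.1)⟩

theorem add (h : Comp inp S ρ e) (h' : Comp inp S ρ e') : Comp inp S ρ (fun a => e a + e' a) :=
  recursion (A := fun a i => e a + i) h' ⟨_, h.bdd.add h'.bdd, fun _ _ hi => Nat.add_le_add_left hi _⟩ h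
    fun _ _ _ ha => ha.succ

theorem mul (h : Comp inp S ρ e) (h' : Comp inp S ρ e') : Comp inp S ρ (fun a => e a * e' a) :=
  recursion (A := fun a i => e a * i) h'
    ⟨_, h.bdd.mul h'.bdd, fun _ _ hi => Nat.mul_le_mul_left _ hi⟩ zero
    fun _ hl _ ha => ha.add (h.lift _ hl)

/-- In the recursion the value at i + 1 is i, so the step simply returns the index. -/
theorem pred (h : Comp inp S ρ e) : Comp inp S ρ (fun a => e a - 1) :=
  recursion (A := fun _ i => i - 1) h ⟨_, h.bdd, fun _ _ hi => by omega⟩ zero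
    fun _ _ hi _ => hi

theorem sub (h : Comp inp S ρ e) (h' : Comp inp S ρ e') : Comp inp S ρ (fun a => e a - e' a) :=
  recursion (A := fun a i => e a - i) h' ⟨_, h.bdd, fun _ _ _ => Nat.sub_le _ _⟩ h
    fun _ _ _ ha => ha.pred

theorem sum {n : α → ℕ} {w : α → ℕ → ℕ} (hn : Comp inp S ρ n)
    (hw : ∀ ρ' : Set ((Σ a, Fin (n a)) → ℕ), liftVars n ρ ⊆ ρ' →
      Comp (fun x => inp x.1) (fun x => S x.1) ρ' (fun x => x.2) →
      Comp (fun x => inp x.1) (fun x => S x.1) ρ' (fun x => w x.1 x.2)) :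
    Comp inp S ρ (fun a => ∑ i ∈ Finset.range (n a), w a i) := by
  -- A uniform bound for the summands is needed before the recursion. It is extracted by taking all
  -- functions as variables, where the index is available trivially.
  obtain ⟨c, hc⟩ := (hw Set.univ (Set.subset_univ _)
    (var trivial ((hn.bdd.comp Sigma.fst).mono fun x => x.2.2.le))).bdd
  refine recursion (A := fun a k => ∑ i ∈ Finset.range k, w a i) hn
    ⟨_, hn.bdd.mul ⟨c, fun a => le_rfl⟩, fun a k hk => ?_⟩ (by simpa using zero)
    fun ρ' hl hi ha => by simpa [Finset.sum_range_succ] using ha.add (hw ρ' hl hi)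
  refine (Finset.sum_le_card_nsmul _ _ ((S a + 2) ^ c) fun i hi => ?_).trans ?_
  · exact hc ⟨a, ⟨i, (Finset.mem_range.1 hi).trans_le hk⟩⟩
  · rw [Finset.card_range, smul_eq_mul]
    exact Nat.mul_le_mul_right _ hk

/-- Powers of two, provided that they are not too large. -/
theorem two_pow (h : Comp inp S ρ e) (hb : Bdd S fun a => 2 ^ e a) :
    Comp inp S ρ (fun a => 2 ^ e a) :=
  recursion (A := fun _ i => 2 ^ i) h
    ⟨_, hb, fun _ _ hi => Nat.pow_le_pow_right (by omega) hi⟩ (const 1)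
    fun _ _ _ ha => by simpa [pow_succ] using ha.mul (const 2)

end Comp

open Classical in
/-- The predicate `p` can be decided in time polynomial in `S`. -/
def Decides (inp : α → List Bool) (S : α → ℕ) (ρ : Set (α → ℕ)) (p : α → Prop) : Prop :=
  Comp inp S ρ (fun a => if p a then 1 else 0)

namespace Decides

theorem congr (h : Decides inp S ρ p) (he : ∀ a, p a ↔ q a) : Decides inp S ρ q :=
  (funext fun a => propext (he a) : p = q) ▸ h

/-- With truncated subtraction, 1 - (e - e') is the indicator of e ≤ e'. -/
theorem le (h : Comp inp S ρ e) (h' : Comp inp S ρ e') :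
    Decides inp S ρ (fun a => e a ≤ e' a) :=
  ((Comp.const 1).sub (h.sub h')).congr fun a => by split_ifs <;> omega

theorem lt (h : Comp inp S ρ e) (h' : Comp inp S ρ e') :
    Decides inp S ρ (fun a => e a < e' a) :=
  le h.succ h'

theorem not (h : Decides inp S ρ p) : Decides inp S ρ (fun a => ¬ p a) :=
  ((Comp.const 1).sub h).congr fun a => by split_ifs <;> first | rfl | contradiction

theorem and (h : Decides inp S ρ p) (h' : Decides inp S ρ q) :
    Decides inp S ρ (fun a => p a ∧ q a) :=
  (Comp.mul h h').congr fun a => by split_ifs <;> simp_all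

theorem or (h : Decides inp S ρ p) (h' : Decides inp S ρ q) :
    Decides inp S ρ (fun a => p a ∨ q a) :=
  (h.not.and h'.not).not.congr fun a => by tauto

theorem imp (h : Decides inp S ρ p) (h' : Decides inp S ρ q) :
    Decides inp S ρ (fun a => p a → q a) :=
  (h.not.or h').congr fun a => by tauto

theorem eq (h : Comp inp S ρ e) (h' : Comp inp S ρ e') :
    Decides inp S ρ (fun a => e a = e' a) :=
  ((le h h').and (le h' h)).congr fun a => by omega

theorem exists_lt {n : α → ℕ} {p : α → ℕ → Prop} (hn : Comp inp S ρ n)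
    (hp : ∀ ρ' : Set ((Σ a, Fin (n a)) → ℕ), liftVars n ρ ⊆ ρ' →
      Comp (fun x => inp x.1) (fun x => S x.1) ρ' (fun x => x.2) →
      Decides (fun x => inp x.1) (fun x => S x.1) ρ' (fun x => p x.1 x.2)) :
    Decides inp S ρ (fun a => ∃ i < n a, p a i) := by
  classical
  refine (le (Comp.const 1) (Comp.sum (w := fun a i => if p a i then 1 else 0) hn
    fun ρ' hl hi => (Comp.congr (hp ρ' hl hi) fun _ => by congr))).congr fun a => ?_
  rw [Finset.sum_boole, Nat.cast_id, Nat.one_le_iff_ne_zero, Finset.card_ne_zero]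
  constructor
  · rintro ⟨i, hi⟩
    rw [Finset.mem_filter, Finset.mem_range] at hi
    exact ⟨i, hi⟩
  · rintro ⟨i, hi⟩
    exact ⟨i, by simpa using hi⟩

theorem forall_lt {n : α → ℕ} {p : α → ℕ → Prop} (hn : Comp inp S ρ n)
    (hp : ∀ ρ' : Set ((Σ a, Fin (n a)) → ℕ), liftVars n ρ ⊆ ρ' →
      Comp (fun x => inp x.1) (fun x => S x.1) ρ' (fun x => x.2) →
      Decides (fun x => inp x.1) (fun x => S x.1) ρ' (fun x => p x.1 x.2)) :
    Decides inp S ρ (fun a => ∀ i < n a, p a i) :=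
  (exists_lt (p := fun a i => ¬ p a i) hn fun ρ' hl hi => (hp ρ' hl hi).not).not.congr
    fun a => by push Not; rfl

end Decides

namespace Comp

theorem ite [∀ a, Decidable (p a)] (hp : Decides inp S ρ p) (h : Comp inp S ρ e)
    (h' : Comp inp S ρ e') : Comp inp S ρ (fun a => if p a then e a else e' a) :=
  ((mul hp h).add (mul hp.not h')).congr fun a => by split_ifs <;> simp_all

theorem div (h : Comp inp S ρ e) (h' : Comp inp S ρ e') : Comp inp S ρ (fun a => e a / e' a) := by
  -- The quotient is the number of i < e with (i + 1)·e' ≤ e. The divisor 0 is treated separately,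
  -- since then every i would count.
  refine (ite (.eq h' (const 0)) (const 0) (sum (w := fun a i => if (i + 1) * e' a ≤ e a then 1
    else 0) h fun ρ' hl hi => ite (.le (hi.succ.mul (h'.lift _ hl)) (h.lift _ hl)) (const 1)
    (const 0))).congr fun a => ?_
  split_ifs with h0
  · simp [h0]
  · have hpos : 0 < e' a := Nat.pos_of_ne_zero h0
    rw [Finset.sum_boole, Nat.cast_id]
    convert Finset.card_range (e a / e' a) using 2
    ext i
    rw [Finset.mem_filter, Finset.mem_range, Finset.mem_range, ← Nat.le_div_iff_mul_le hpos,
      Nat.succ_le_iff]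
    exact ⟨fun h => h.2, fun h => ⟨h.trans_le (Nat.div_le_self _ _), h⟩⟩

theorem mod (h : Comp inp S ρ e) (h' : Comp inp S ρ e') : Comp inp S ρ (fun a => e a % e' a) :=
  (h.sub (h'.mul (h.div h'))).congr fun a => by
    have := Nat.mod_add_div (e a) (e' a); omega

/-- Repeated halving avoids the power of two itself, which may be too large for a unary register. -/
theorem div_two_pow (h : Comp inp S ρ e) (h' : Comp inp S ρ e') :
    Comp inp S ρ (fun a => e a / 2 ^ e' a) :=
  recursion (A := fun a i => e a / 2 ^ i) h' ⟨_, h.bdd, fun a i _ => Nat.div_le_self _ _⟩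
    (by simpa using h) fun _ _ _ ha => (ha.div (const 2)).congr fun a => by
      rw [pow_succ, Nat.div_div_eq_div_mul]

theorem size (h : Comp inp S ρ e) : Comp inp S ρ (fun a => (e a).size) := by
  refine (sum (w := fun a i => if 0 < e a / 2 ^ i then 1 else 0) h fun ρ' hl hi =>
    ite (.lt (const 0) ((h.lift _ hl).div_two_pow hi)) (const 1) (const 0)).congr fun a => ?_
  rw [Finset.sum_boole, Nat.cast_id]
  convert Finset.card_range (e a).size using 2
  ext i
  rw [Finset.mem_filter, Finset.mem_range, Finset.mem_range, Nat.lt_size,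
    Nat.div_pos_iff]
  refine ⟨fun h => h.2.2, fun h => ⟨Nat.lt_two_pow_self.trans_le h, by positivity, h⟩⟩

end Comp

namespace Decides

theorem testBit (h : Comp inp S ρ e) (h' : Comp inp S ρ e') :
    Decides inp S ρ (fun a => (e a).testBit (e' a) = true) :=
  (eq ((h.div_two_pow h').mod (.const 2)) (.const 1)).congr fun a => by
    rw [Nat.testBit_eq_decide_div_mod_eq, decide_eq_true_iff]

theorem bit (hl : Bdd S fun a => (inp a).length) (h : Comp inp S ρ e) :
    Decides inp S ρ (fun a => (inp a)[e a]?.getD false = true) :=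
  (Comp.bit hl h).congr fun a => by
    rcases h : (inp a)[e a]?.getD false with _ | _ <;> simp [h]

end Decides

namespace Emits

theorem congr {w w' : α → List Bool} (h : Emits inp S ρ w) (hw : ∀ a, w a = w' a) :
    Emits inp S ρ w' :=
  funext hw ▸ h

theorem cond {w w' : α → List Bool} [∀ a, Decidable (p a)] (hp : Decides inp S ρ p)
    (h : Emits inp S ρ w) (h' : Emits inp S ρ w') :
    Emits inp S ρ (fun a => if p a then w a else w' a) :=
  (Emits.ite hp h h').congr fun a => by split_ifs <;> simp_all

theorem loop {n : α → ℕ} {w : α → ℕ → List Bool} (hn : Comp inp S ρ n)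
    (hw : ∀ ρ' : Set ((Σ a, Fin (n a)) → ℕ), liftVars n ρ ⊆ ρ' →
      Comp (fun x => inp x.1) (fun x => S x.1) ρ' (fun x => x.2) →
      Emits (fun x => inp x.1) (fun x => S x.1) ρ' (fun x => w x.1 x.2)) :
    Emits inp S ρ (fun a => (List.range (n a)).flatMap (w a)) :=
  flatMap hn (hw _ (fun _ hg => .inr hg)
    (.var (.inl rfl) ((hn.bdd.comp Sigma.fst).mono fun x => x.2.2.le)))

end Emits

theorem bits_eq_map_testBit (k : ℕ) : k.bits = (List.range k.size).map k.testBit := by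
  refine List.ext_getElem (by simp [Nat.size_eq_bits_len]) fun i h _ => ?_
  rw [List.getElem_map, List.getElem_range, Nat.testBit_eq_inth, List.getI_eq_getElem _ h]

theorem Emits.encodeNatBits (h : Comp inp S ρ e) :
    Emits inp S ρ (fun a => encodeNatBits (e a)) := by
  refine ((loop (w := fun a i => true :: if (e a).testBit i = true then [true] else [false]) h.size
    fun ρ' hl hi => (Emits.cond (.testBit (h.lift _ hl) hi) (singleton true)
      (singleton false)).cons true).append (singleton false)).congr fun a => ?_
  rw [_root_.encodeNatBits, encodeListWith, bits_eq_map_testBit, List.flatMap_map]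
  congr 2
  funext i
  cases (e a).testBit i <;> rfl

end Arithmetic

/-! ### Parsing codes -/

/-- The bit at a position of a bit string (`false` beyond the end). -/
def bitAt (x : List Bool) (i : ℕ) : Bool := x[i]?.getD false

theorem bitAt_add (x : List Bool) (i j : ℕ) : bitAt x (i + j) = bitAt (x.drop i) j := by
  simp [bitAt]

/-- The number of binary digits of the number whose code starts at the position `i`. -/
def digitsAt (x : List Bool) (i : ℕ) : ℕ :=
  ∑ k ∈ Finset.range x.length, if ∀ j < k + 1, bitAt x (i + 2 * j) = true then 1 else 0

/-- The number whose code starts at the position `i`, provided that it is at most `c`. -/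
def numAt (x : List Bool) (c i : ℕ) : ℕ :=
  ∑ k ∈ Finset.range (digitsAt x i), if bitAt x (i + 2 * k + 1) = true then min (2 ^ k) c else 0

theorem length_encodeNatBits (m : ℕ) : (encodeNatBits m).length = 2 * m.size + 1 := by
  simp [encodeNatBits, encodeListWith, List.length_flatMap, Nat.size_eq_bits_len, mul_comm]

/-- Even positions carry the continuation markers, the last of which is `false`, and odd positions
carry the digits. -/
theorem bitAt_digits (bs : List Bool) (r : List Bool) (j : ℕ) :
    (j ≤ bs.length → bitAt (encodeListWith (fun b => [b]) bs ++ r) (2 * j) = decide (j < bs.length)) ∧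
    (∀ h : j < bs.length, bitAt (encodeListWith (fun b => [b]) bs ++ r) (2 * j + 1) = bs[j]) := by
  induction bs generalizing j with
  | nil => exact ⟨fun hj => by simp [encodeListWith, bitAt, Nat.le_zero.1 hj], by simp⟩
  | cons b bs ih =>
    rcases j with _ | j
    · simp [encodeListWith, bitAt]
    · have h := ih j
      simp only [encodeListWith, List.flatMap_cons, bitAt, mul_add, List.append_assoc,
        List.cons_append, List.nil_append, List.length_cons, List.getElem?_cons_succ,
        add_le_add_iff_right, add_lt_add_iff_right, List.getElem_cons_succ, mul_one,
        show 2 * j + 2 + 1 = 2 * j + 1 + 2 from rfl] at h ⊢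
      exact h

theorem digitsAt_eq {x r : List Bool} {i m : ℕ} (h : x.drop i = encodeNatBits m ++ r) :
    digitsAt x i = m.size := by
  have hb : ∀ j ≤ m.size, bitAt x (i + 2 * j) = decide (j < m.size) := fun j hj => by
    rw [bitAt_add, h, ← Nat.size_eq_bits_len]
    exact (bitAt_digits m.bits r j).1 (by rwa [Nat.size_eq_bits_len])
  have hl : m.size ≤ x.length := by
    have := congrArg List.length h
    rw [List.length_append, length_encodeNatBits, List.length_drop] at this
    omega
  rw [digitsAt, Finset.sum_boole, Nat.cast_id]
  convert Finset.card_range m.size using 2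
  ext k
  rw [Finset.mem_filter, Finset.mem_range, Finset.mem_range]
  constructor
  -- Otherwise the markers tested would include the one with index `m.size`, which is the `false`
  -- that ends the code.
  · rintro ⟨_, hk⟩
    by_contra hkm
    have := hk m.size (by omega)
    simp [hb m.size le_rfl] at this
  · exact fun hk => ⟨by omega, fun j hj => by simp [hb j (by omega)]; omega⟩

theorem sum_testBit (m n : ℕ) :
    ∑ k ∈ Finset.range n, (if m.testBit k = true then 2 ^ k else 0) = m % 2 ^ n := by
  induction n with
  | zero => simp [Nat.mod_one]
  | succ n ih =>
    rw [Finset.sum_range_succ, ih, Nat.mod_pow_succ, Nat.testBit_eq_decide_div_mod_eq]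
    rcases Nat.mod_two_eq_zero_or_one (m / 2 ^ n) with h | h <;> simp [h]

theorem numAt_eq {x r : List Bool} {i m c : ℕ} (h : x.drop i = encodeNatBits m ++ r)
    (hc : m ≤ c) : numAt x c i = m := by
  rw [numAt, digitsAt_eq h]
  have hm : m % 2 ^ m.size = m := Nat.mod_eq_of_lt (Nat.lt_size_self m)
  conv_rhs => rw [← hm, ← sum_testBit]
  refine Finset.sum_congr rfl fun k hk => ?_
  have hk' : k < m.bits.length := by rw [Nat.size_eq_bits_len]; exact Finset.mem_range.1 hk
  have hb : bitAt x (i + 2 * k + 1) = m.testBit k := by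
    rw [add_assoc, bitAt_add, h, Nat.testBit_eq_inth, List.getI_eq_getElem _ hk']
    exact (bitAt_digits m.bits r k).2 hk'
  rw [hb]
  split_ifs with ht
  -- A digit 1 at place k forces 2^k ≤ m ≤ c, so the cap has no effect on an actual code.
  · exact min_eq_left ((Nat.ge_two_pow_of_testBit ht).trans hc)
  · rfl

/-- One step of a scan through a list of clauses: the number `c` encodes a position (`c / 8`), whether
the position is inside a clause (`c / 4 % 2`), whether all literals of the clause so far satisfy `F`
(`c / 2 % 2`), and whether there was a clause all of whose literals satisfy `F` (`c % 2`). -/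
def scanStep (x : List Bool) (m : ℕ) (F : ℕ → Bool → Prop) [∀ v b, Decidable (F v b)] (c : ℕ) : ℕ :=
  if bitAt x (c / 8) = true then
    if c / 4 % 2 = 0 then (c / 8 + 1) * 8 + 6 + c % 2
    else (c / 8 + 3 + 2 * digitsAt x (c / 8 + 2)) * 8 + 4 +
      (if c / 2 % 2 = 1 ∧ F (numAt x m (c / 8 + 2)) (bitAt x (c / 8 + 1)) then 2 else 0) + c % 2
  else if c / 4 % 2 = 0 then c
  else (c / 8 + 1) * 8 + if c % 2 = 1 ∨ c / 2 % 2 = 1 then 1 else 0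

/-- The code of a literal. -/
def encodeLit {n : ℕ} (l : Fin n × Bool) : List Bool := l.2 :: encodeNatBits l.1

/-! ### Correctness of the scan through the clauses. -/

section Scan

variable {x : List Bool} {m : ℕ} {F : ℕ → Bool → Prop} [∀ v b, Decidable (F v b)] {n : ℕ}

theorem digitsAt_le (x : List Bool) (i : ℕ) : digitsAt x i ≤ x.length := by
  rw [digitsAt, Finset.sum_boole, Nat.cast_id]
  exact (Finset.card_filter_le _ _).trans (Finset.card_range _).le

/-- A step skips at most 3 + 2·|x| positions, and a position has the weight 8. This keeps the state
polynomially large during a scan of |x| steps. -/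
theorem scanStep_le (c : ℕ) : scanStep x m F c ≤ c + (16 * x.length + 40) := by
  have := digitsAt_le x (c / 8 + 2)
  unfold scanStep
  split_ifs <;> omega

/-- Here `a` tells whether all literals read so far satisfy `F`, and `v` whether an earlier clause
succeeded; `a` is arbitrary for the sake of the induction. One step reads a whole literal, so there
are at most as many steps as bits. -/
theorem scan_clause (hn : n ≤ m) (C : List (Fin n × Bool)) (i a v : ℕ) (ha : a < 2) (hv : v < 2)
    (r : List Bool) (h : x.drop i = encodeListWith encodeLit C ++ r) :
    ∃ k ≤ (encodeListWith encodeLit C).length, (scanStep x m F)^[k] (i * 8 + 4 + a * 2 + v) =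
      (i + (encodeListWith encodeLit C).length) * 8 +
        if v = 1 ∨ (a = 1 ∧ ∀ l ∈ C, F l.1 l.2) then 1 else 0 := by
  have e1 : (i * 8 + 4 + a * 2 + v) / 8 = i := by omega
  have e2 : (i * 8 + 4 + a * 2 + v) / 4 % 2 = 1 := by omega
  have e3 : (i * 8 + 4 + a * 2 + v) / 2 % 2 = a := by omega
  have e4 : (i * 8 + 4 + a * 2 + v) % 2 = v := by omega
  have hb : bitAt x i = bitAt (x.drop i) 0 := bitAt_add x i 0
  induction C generalizing i a with
  | nil =>
    refine ⟨1, by simp [encodeListWith], ?_⟩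
    rw [h] at hb
    rw [Function.iterate_one, scanStep, e1, e2, e3, e4, hb]
    simp [encodeListWith, bitAt]
  | cons l C ih =>
    have hx : x.drop i = true :: l.2 :: (encodeNatBits l.1 ++ (encodeListWith encodeLit C ++ r)) := by
      rw [h]; simp [encodeListWith, encodeLit]
    have hx2 : x.drop (i + 2) = encodeNatBits l.1 ++ (encodeListWith encodeLit C ++ r) := by
      rw [← List.drop_drop, hx]; rfl
    have hx3 : x.drop (i + 3 + 2 * (l.1 : ℕ).size) = encodeListWith encodeLit C ++ r := by
      rw [show i + 3 + 2 * (l.1 : ℕ).size = i + 2 + (encodeNatBits l.1).length by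
        rw [length_encodeNatBits]; omega, ← List.drop_drop, hx2, List.drop_left]
    have hs : bitAt x (i + 1) = l.2 := by rw [bitAt_add, hx]; rfl
    have hnum : numAt x m (i + 2) = l.1 := numAt_eq hx2 (l.1.2.le.trans hn)
    have hlen : (encodeListWith encodeLit (l :: C)).length =
        3 + 2 * (l.1 : ℕ).size + (encodeListWith encodeLit C).length := by
      simp [encodeListWith, encodeLit, length_encodeNatBits]; omega
    classical
    obtain ⟨k, hk, hk'⟩ := ih (i + 3 + 2 * (l.1 : ℕ).size) (if a = 1 ∧ F l.1 l.2 then 1 else 0)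
      (by split_ifs <;> omega) hx3 (by split_ifs <;> omega) (by split_ifs <;> omega)
      (by split_ifs <;> omega) (by split_ifs <;> omega) (bitAt_add x _ 0)
    refine ⟨k + 1, by omega, ?_⟩
    rw [Function.iterate_succ_apply, scanStep, e1, e2, e3, e4, hb, hx, hs, hnum, digitsAt_eq hx2,
      if_pos (by rfl), if_neg (by omega)]
    have e5 : ((i + 3 + 2 * (l.1 : ℕ).size) * 8 + 4 + (if a = 1 ∧ F l.1 l.2 then 2 else 0) + v) =
      ((i + 3 + 2 * (l.1 : ℕ).size) * 8 + 4 + (if a = 1 ∧ F l.1 l.2 then 1 else 0) * 2 + v) := by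
      split_ifs <;> omega
    rw [e5, hk', hlen]
    congr 1
    · ring
    · by_cases h1 : a = 1 <;> by_cases h2 : F l.1 l.2 <;> simp [h1, h2]

/-- The state reached at the end of the list is a fixed point of `scanStep`, so superfluous steps
are harmless and the scan may be run for |x| steps. -/
theorem scan_clauses (hn : n ≤ m) (L : List (List (Fin n × Bool))) (i v : ℕ) (hv : v < 2)
    (r : List Bool) (h : x.drop i = encodeListWith (encodeListWith encodeLit) L ++ r) :
    ∃ k ≤ (encodeListWith (encodeListWith encodeLit) L).length, ∃ q,
      (scanStep x m F)^[k] (i * 8 + v) = q ∧ scanStep x m F q = q ∧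
        (q % 2 = 1 ↔ v = 1 ∨ ∃ C ∈ L, ∀ l ∈ C, F l.1 l.2) := by
  have e1 : (i * 8 + v) / 8 = i := by omega
  have e2 : (i * 8 + v) / 4 % 2 = 0 := by omega
  have e4 : (i * 8 + v) % 2 = v := by omega
  have hb : bitAt x i = bitAt (x.drop i) 0 := bitAt_add x i 0
  induction L generalizing i v with
  | nil =>
    refine ⟨0, by omega, _, rfl, ?_, by simp [e4]⟩
    rw [h] at hb
    rw [Function.iterate_zero_apply, scanStep, e1, e2, hb]
    simp [encodeListWith, bitAt]
  | cons C L ih =>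
    have hx : x.drop i = true :: (encodeListWith encodeLit C ++
        (encodeListWith (encodeListWith encodeLit) L ++ r)) := by
      rw [h]; simp [encodeListWith]
    have hx1 : x.drop (i + 1) = encodeListWith encodeLit C ++
        (encodeListWith (encodeListWith encodeLit) L ++ r) := by
      rw [← List.drop_drop, hx]; rfl
    obtain ⟨k, hk, hk'⟩ := scan_clause (F := F) hn C (i + 1) 1 v (by omega) hv _ hx1
    have hx2 : x.drop (i + 1 + (encodeListWith encodeLit C).length) =
        encodeListWith (encodeListWith encodeLit) L ++ r := by
      rw [← List.drop_drop, hx1, List.drop_left]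
    classical
    obtain ⟨k2, hk2, q, hq, hq1, hq2⟩ := ih (i + 1 + (encodeListWith encodeLit C).length)
      (if v = 1 ∨ ∀ l ∈ C, F l.1 l.2 then 1 else 0) (by split_ifs <;> omega) hx2
      (by split_ifs <;> omega) (by split_ifs <;> omega) (by split_ifs <;> omega) (bitAt_add x _ 0)
    have hlen : (encodeListWith (encodeListWith encodeLit) (C :: L)).length =
        1 + (encodeListWith encodeLit C).length +
          (encodeListWith (encodeListWith encodeLit) L).length := by
      simp [encodeListWith]; omega
    refine ⟨k2 + (k + 1), by omega, q, ?_, hq1, ?_⟩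
    · rw [Function.iterate_add_apply, Function.iterate_succ_apply, scanStep, e1, e2, e4, hb, hx,
        if_pos (by rfl), if_pos rfl, ← hq]
      congr 1
      rw [show (i + 1) * 8 + 6 + v = (i + 1) * 8 + 4 + 1 * 2 + v by omega, hk']
      simp
    · rw [hq2]
      simp only [List.mem_cons, exists_eq_or_imp]
      by_cases h1 : v = 1 <;> by_cases h2 : ∀ l ∈ C, F l.1 l.2 <;> simp_all

theorem scan_iff (hn : n ≤ m) (L : List (List (Fin n × Bool))) (i : ℕ)
    (h : x.drop i = encodeListWith (encodeListWith encodeLit) L) :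
    (scanStep x m F)^[x.length] (i * 8) % 2 = 1 ↔ ∃ C ∈ L, ∀ l ∈ C, F l.1 l.2 := by
  obtain ⟨k, hk, q, hq, hq1, hq2⟩ := scan_clauses (F := F) hn L i 0 (by omega) [] (by simpa using h)
  have hkx : k ≤ x.length := by
    rw [← h, List.length_drop] at hk
    omega
  rw [← Nat.sub_add_cancel hkx, Function.iterate_add_apply]
  rw [add_zero] at hq
  rw [hq, Function.iterate_fixed hq1, hq2]
  simp

end Scan

/-! ### Computing the parser -/

section

variable {α : Type} {inp : α → List Bool} {S : α → ℕ} {ρ : Set (α → ℕ)} {e e' : α → ℕ}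

theorem Decides.bitAt (hl : Bdd S fun a => (inp a).length) (h : Comp inp S ρ e) :
    Decides inp S ρ (fun a => bitAt (inp a) (e a) = true) :=
  Decides.bit hl h

namespace Comp

theorem digitsAt (hl : Bdd S fun a => (inp a).length) (h : Comp inp S ρ e) :
    Comp inp S ρ (fun a => digitsAt (inp a) (e a)) :=
  sum (length hl) fun _ hρ hk => ite
    (.forall_lt (p := fun x j => bitAt (inp x.1) (e x.1 + 2 * j) = true) hk.succ
      fun _ hρ' hj => .bitAt ((hl.comp Sigma.fst).comp Sigma.fst)
        (((h.lift _ hρ).lift _ hρ').add ((const 2).mul hj)))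
    (const 1) (const 0)

theorem min (h : Comp inp S ρ e) (h' : Comp inp S ρ e') :
    Comp inp S ρ (fun a => min (e a) (e' a)) :=
  (ite (.le h h') h h').congr fun _ => (min_def _ _).symm

/-- The cap is applied after each doubling, so the register never holds the possibly exponential
power. This is needed because `numAt` is evaluated also at positions where no code starts. -/
theorem two_pow_min (h : Comp inp S ρ e) (h' : Comp inp S ρ e') :
    Comp inp S ρ (fun a => Min.min (2 ^ e a) (e' a)) :=
  recursion (A := fun a i => Min.min (2 ^ i) (e' a)) h ⟨_, h'.bdd, fun _ _ _ => min_le_right _ _⟩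
    (by simpa using (const 1).min h') fun _ hρ _ ha =>
      (((const 2).mul ha).min (h'.lift _ hρ)).congr fun x => by rw [pow_succ]; omega

theorem numAt (hl : Bdd S fun a => (inp a).length) {c : α → ℕ} (hc : Comp inp S ρ c)
    (h : Comp inp S ρ e) : Comp inp S ρ (fun a => numAt (inp a) (c a) (e a)) :=
  sum (h.digitsAt hl) fun _ hρ hk => ite
    (.bitAt (hl.comp Sigma.fst) (((h.lift _ hρ).add ((const 2).mul hk)).add (const 1)))
    (two_pow_min hk (hc.lift _ hρ)) (const 0)

theorem scanStep {F : α → ℕ → Bool → Prop} [∀ a v b, Decidable (F a v b)]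
    (hl : Bdd S fun a => (inp a).length) {m c : α → ℕ} (hc : Comp inp S ρ c)
    (hF : Decides inp S ρ
      (fun a => F a (_root_.numAt (inp a) (m a) (c a / 8 + 2)) (_root_.bitAt (inp a) (c a / 8 + 1)))) :
    Comp inp S ρ (fun a => scanStep (inp a) (m a) (F a) (c a)) := by
  have hp := hc.div (const 8)
  have h1 : Decides inp S ρ (fun a => c a % 2 = 1) := .eq (hc.mod (const 2)) (const 1)
  have h2 : Decides inp S ρ (fun a => c a / 2 % 2 = 1) :=
    .eq ((hc.div (const 2)).mod (const 2)) (const 1)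
  have h4 : Decides inp S ρ (fun a => c a / 4 % 2 = 0) :=
    .eq ((hc.div (const 4)).mod (const 2)) (const 0)
  exact ite (.bitAt hl hp)
    (ite h4 ((((hp.add (const 1)).mul (const 8)).add (const 6)).add (hc.mod (const 2)))
      ((((((hp.add (const 3)).add ((const 2).mul ((hp.add (const 2)).digitsAt hl))).mul
        (const 8)).add (const 4)).add (ite (h2.and hF) (const 2) (const 0))).add
        (hc.mod (const 2))))
    (ite h4 hc (((hp.add (const 1)).mul (const 8)).add (ite (h1.or h2) (const 1) (const 0))))

end Comp

/-- The literal `(v, c)` is false, given that the number `b` describes the values of the variables in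
the block `p` of the variables; the blocks have the length `w`. -/
def Falsified (w p b v : ℕ) (c : Bool) : Prop := v / w = p ∧ b.testBit (v % w) ≠ c

instance (w p b v : ℕ) (c : Bool) : Decidable (Falsified w p b v c) :=
  inferInstanceAs (Decidable (_ ∧ _))

/-- The literal `(v, c)` is false, given the values of the variables in three blocks. -/
def Falsified₃ (w p₀ b₀ p₁ b₁ p₂ b₂ v : ℕ) (c : Bool) : Prop :=
  Falsified w p₀ b₀ v c ∨ Falsified w p₁ b₁ v c ∨ Falsified w p₂ b₂ v c

instance (w p₀ b₀ p₁ b₁ p₂ b₂ v : ℕ) (c : Bool) :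
    Decidable (Falsified₃ w p₀ b₀ p₁ b₁ p₂ b₂ v c) :=
  inferInstanceAs (Decidable (_ ∨ _ ∨ _))

variable {w p b v p₀ b₀ p₁ b₁ p₂ b₂ m c : α → ℕ} {σ : α → Bool}

theorem Decides.falsified (hw : Comp inp S ρ w) (hp : Comp inp S ρ p) (hb : Comp inp S ρ b)
    (hv : Comp inp S ρ v) (hσ : Decides inp S ρ (fun a => σ a = true)) :
    Decides inp S ρ (fun a => Falsified (w a) (p a) (b a) (v a) (σ a)) := by
  have ht := testBit hb (hv.mod hw)
  refine ((eq (hv.div hw) hp).and ((ht.imp hσ).and (hσ.imp ht)).not).congr fun a => ?_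
  unfold Falsified
  rcases h1 : (b a).testBit (v a % w a) with _ | _ <;> rcases h2 : σ a with _ | _ <;> simp

theorem Decides.scan (hl : Bdd S fun a => (inp a).length) (hw : Comp inp S ρ w)
    (hp₀ : Comp inp S ρ p₀) (hb₀ : Comp inp S ρ b₀) (hp₁ : Comp inp S ρ p₁)
    (hb₁ : Comp inp S ρ b₁) (hp₂ : Comp inp S ρ p₂) (hb₂ : Comp inp S ρ b₂)
    (hm : Comp inp S ρ m) (hc : Comp inp S ρ c) :
    Decides inp S ρ (fun a => (scanStep (inp a) (m a)
      (Falsified₃ (w a) (p₀ a) (b₀ a) (p₁ a) (b₁ a) (p₂ a) (b₂ a)))^[(inp a).length] (c a) % 2 = 1) := by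
  refine eq (Comp.mod (Comp.recursion (A := fun a i => (scanStep (inp a) (m a)
      (Falsified₃ (w a) (p₀ a) (b₀ a) (p₁ a) (b₁ a) (p₂ a) (b₂ a)))^[i] (c a)) (Comp.length hl)
      ⟨fun a => c a + (inp a).length * (16 * (inp a).length + 40),
        hc.bdd.add (hl.mul (((Bdd.const 16).mul hl).add (.const 40))), fun a i hi => ?_⟩
      hc fun ρ' hρ _ ha => ?_) (.const 2)) (.const 1)
  · have : ∀ i, (scanStep (inp a) (m a)
        (Falsified₃ (w a) (p₀ a) (b₀ a) (p₁ a) (b₁ a) (p₂ a) (b₂ a)))^[i] (c a) ≤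
        c a + i * (16 * (inp a).length + 40) := by
      intro i
      induction i with
      | zero => simp
      | succ i ih =>
        rw [Function.iterate_succ_apply', add_mul]
        exact (scanStep_le _).trans (by omega)
    exact (this i).trans (Nat.add_le_add_left (Nat.mul_le_mul_right _ hi) _)
  · have hl' := hl.comp (Sigma.fst : (Σ a, Fin (inp a).length) → α)
    have hpos := ha.div (.const 8)
    have hv := Comp.numAt hl' (hm.lift _ hρ) (hpos.add (.const 2))
    have hσ := Decides.bitAt hl' (hpos.add (.const 1))
    have hw' := hw.lift _ hρ
    refine (Comp.scanStep (F := fun x => Falsified₃ (w x.1) (p₀ x.1) (b₀ x.1) (p₁ x.1) (b₁ x.1)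
      (p₂ x.1) (b₂ x.1)) (m := fun x => m x.1) hl' ha ?_).congr fun x => ?_
    · exact (falsified hw' (hp₀.lift _ hρ) (hb₀.lift _ hρ) hv hσ).or
        ((falsified hw' (hp₁.lift _ hρ) (hb₁.lift _ hρ) hv hσ).or
        (falsified hw' (hp₂.lift _ hρ) (hb₂.lift _ hρ) hv hσ))
    · rw [Function.iterate_succ_apply']

end

/-! ### The reduction -/

/-- The number of blocks into which `N` variables are divided. -/
def blocks (N : ℕ) : ℕ := N.size + 1

/-- The length of the blocks. -/
def blockLen (N : ℕ) : ℕ := N / blocks N + 1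

/-- The number of assignments of a block. -/
def base (N : ℕ) : ℕ := 2 ^ blockLen N

/-- The number of colors. -/
def colors (N : ℕ) : ℕ := 2 ^ (3 * blockLen N)

/-- The number of vertices: the vertices `0` and `1` fix the colors `1` and `colors N` (up to a
reflection), then there is a vertex for every block and one for every pair of blocks. -/
def vertices (N : ℕ) : ℕ := 2 + blocks N + blocks N * blocks N

namespace ThreeCNF

/-- The vertex for the block `p` and the vertex for the blocks `q / g` and `q % g` must not have the
distance `d`, whose digits to the base `base N` describe the assignments of the blocks. -/
def Conflict (φ : ThreeCNF) (p q d : ℕ) : Prop :=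
  let A := base φ.numVars
  let g := blocks φ.numVars
  (p = q / g ∧ d % A ≠ d / A % A) ∨ (p = q % g ∧ d % A ≠ d / A / A) ∨
    ∃ C ∈ φ.clauses, ∀ l ∈ C,
      Falsified₃ (blockLen φ.numVars) p (d % A) (q / g) (d / A % A) (q % g) (d / A / A) l.1 l.2

/-- The distance `d` is forbidden for the vertices `i` and `j`, where `i < j`. -/
def Forbidden (φ : ThreeCNF) (i j d : ℕ) : Prop :=
  let A := base φ.numVars
  let g := blocks φ.numVars
  (i = 0 ∧ j = 1 ∧ d + 1 ≠ colors φ.numVars) ∨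
  (i = 0 ∧ 2 ≤ j ∧ j < 2 + g ∧ A ≤ d) ∨
  (i = 0 ∧ 2 + g ≤ j ∧ (d + 1) % A ≠ 0) ∨
  (2 ≤ i ∧ i < 2 + g ∧ 2 + g ≤ j ∧ φ.Conflict (i - 2) (j - (2 + g)) d)

open Classical in
/-- The instance of Generalized `T`-Coloring that belongs to a formula. -/
noncomputable def toColoring (φ : ThreeCNF) : GenTColoring where
  n := vertices φ.numVars
  G := ⊤
  s := colors φ.numVars
  -- Minimum and maximum turn the unordered edge into a pair i < j. The graph can be complete, since
  -- an edge with no forbidden distance imposes nothing.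
  t e := (Finset.range (colors φ.numVars)).filter
    (φ.Forbidden (e.1.inf : Fin (vertices φ.numVars)) (e.1.sup : Fin (vertices φ.numVars)))

end ThreeCNF

theorem sort_filter_range (n : ℕ) (p : ℕ → Prop) [DecidablePred p] :
    ((Finset.range n).filter p).sort (· ≤ ·) = (List.range n).filter p := by
  rw [← (List.toFinset_sort (r := (· ≤ ·)) (List.nodup_range.filter _)).2
    ((List.pairwise_le_range (n := n)).filter _)]
  congr 1
  ext i
  simp

theorem flatMap_finRange {β : Type} (n : ℕ) (f : ℕ → List β) :
    (List.finRange n).flatMap (fun i : Fin n => f i) = (List.range n).flatMap f := by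
  rw [← List.map_coe_finRange_eq_range, List.flatMap_map]

theorem encodeListWith_filter {β : Type} (e : β → List Bool) (L : List β) (p : β → Prop)
    [DecidablePred p] :
    encodeListWith e (L.filter p) = L.flatMap (fun x => if p x then true :: e x else []) ++ [false] := by
  rw [encodeListWith]
  congr 1
  induction L with
  | nil => rfl
  | cons x L ih => by_cases h : p x <;> simp [h, ih]

namespace ThreeCNF

open Classical in
theorem toColoring_t (φ : ThreeCNF) {i j : Fin (vertices φ.numVars)} (hij : i < j)
    (h : φ.toColoring.G.Adj i j) : φ.toColoring.t ⟨s(i, j), h⟩ =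
      (Finset.range (colors φ.numVars)).filter (φ.Forbidden i j) :=
  congrArg₂ (fun a b : Fin (vertices φ.numVars) =>
    (Finset.range (colors φ.numVars)).filter (φ.Forbidden a b))
    (inf_of_le_left hij.le) (sup_of_le_right hij.le)

open Classical in
/-- The part of the code of `φ.toColoring` that belongs to the pair `ij`. -/
noncomputable def edgeCode (φ : ThreeCNF) (i j : ℕ) : List Bool :=
  if i < j then true :: ((List.range (colors φ.numVars)).flatMap (fun d =>
    if φ.Forbidden i j d then true :: encodeNatBits d else []) ++ [false]) else []

theorem encode_toColoring (φ : ThreeCNF) :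
    φ.toColoring.encode = encodeNatBits (vertices φ.numVars) ++ encodeNatBits (colors φ.numVars) ++
      (List.range (vertices φ.numVars)).flatMap fun i =>
        (List.range (vertices φ.numVars)).flatMap (φ.edgeCode i) := by
  classical
  rw [GenTColoring.encode]
  congr 1
  refine Eq.trans ?_ (flatMap_finRange _ _)
  refine congrArg (fun f => List.flatMap f _) (funext fun i => ?_)
  refine Eq.trans ?_ (flatMap_finRange _ _)
  refine congrArg (fun f => List.flatMap f _) (funext fun j => ?_)
  by_cases hij : i < j
  · have hadj : φ.toColoring.G.Adj i j := hij.ne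
    have hij' : (i : ℕ) < j := hij
    rw [edgeCode, if_pos hij, if_pos hij', dif_pos hadj]
    rw [toColoring_t φ hij, sort_filter_range, encodeListWith_filter]
  · rw [edgeCode, if_neg hij, if_neg (by simpa using hij)]

/-- The bound for the time of the reduction is polynomial in this number. -/
def resource (φ : ThreeCNF) : ℕ := φ.encode.length + φ.numVars + colors φ.numVars

theorem encode_eq (φ : ThreeCNF) : φ.encode = encodeNatBits φ.numVars ++
    encodeListWith (encodeListWith encodeLit) φ.clauses := rfl

theorem bdd_length : Bdd resource fun φ => φ.encode.length :=
  (Bdd.self _).mono fun φ => by unfold resource; omega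

theorem bdd_numVars : Bdd resource fun φ => φ.numVars :=
  (Bdd.self _).mono fun φ => by unfold resource; omega

theorem bdd_colors : Bdd resource fun φ => colors φ.numVars :=
  (Bdd.self _).mono fun φ => by unfold resource; omega

/-! ### Computability of the parameters of the instance. -/

section

variable {ρ : Set (ThreeCNF → ℕ)}

theorem comp_size : Comp encode resource ρ fun φ => φ.numVars.size :=
  (Comp.digitsAt bdd_length (.const 0)).congr fun φ =>
    digitsAt_eq (r := encodeListWith (encodeListWith encodeLit) φ.clauses) rfl

theorem comp_numVars : Comp encode resource ρ fun φ => φ.numVars := by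
  -- The cap 2^size exceeds N, so the number is read correctly, and it is at most 2N + 1, so it fits
  -- into a register.
  refine (Comp.numAt bdd_length (comp_size.two_pow (((bdd_numVars.mul (.const 2)).add
    (.const 1)).mono fun φ => ?_)) (.const 0)).congr fun φ => ?_
  · rcases h : φ.numVars.size with _ | k
    · simp
    · have := Nat.lt_size.1 (show k < φ.numVars.size by omega)
      rw [pow_succ]; omega
  · exact numAt_eq (r := encodeListWith (encodeListWith encodeLit) φ.clauses) rfl
      (Nat.lt_size_self _).le

theorem comp_blocks : Comp encode resource ρ fun φ => blocks φ.numVars := comp_size.succ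

theorem comp_blockLen : Comp encode resource ρ fun φ => blockLen φ.numVars :=
  (comp_numVars.div comp_blocks).succ

theorem comp_base : Comp encode resource ρ fun φ => base φ.numVars :=
  comp_blockLen.two_pow (bdd_colors.mono fun _ =>
    Nat.pow_le_pow_right (by omega) (by omega))

theorem comp_colors : Comp encode resource ρ fun φ => colors φ.numVars :=
  ((Comp.const 3).mul comp_blockLen).two_pow bdd_colors

theorem comp_vertices : Comp encode resource ρ fun φ => vertices φ.numVars :=
  ((Comp.const 2).add comp_blocks).add (comp_blocks.mul comp_blocks)

end

/-- The scan starts right behind the code of the number of variables, with all flags zero. -/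
theorem clauses_iff (φ : ThreeCNF) (F : ℕ → Bool → Prop) [∀ v b, Decidable (F v b)] :
    (scanStep φ.encode φ.numVars F)^[φ.encode.length]
      ((2 * φ.numVars.size + 1) * 8) % 2 = 1 ↔ ∃ C ∈ φ.clauses, ∀ l ∈ C, F l.1 l.2 :=
  scan_iff le_rfl φ.clauses _ (by rw [encode_eq, ← length_encodeNatBits, List.drop_left])

/-! ### Computability of the constraints and of the code of the instance. -/

section

variable {β : Type} {π : β → ThreeCNF} {ρ : Set (β → ℕ)} {i j d p q : β → ℕ}

/-- Computability of functions of a formula in a larger context. -/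
theorem _root_.Comp.pullback {e : ThreeCNF → ℕ} (h : Comp encode resource ∅ e) :
    Comp (fun x => encode (π x)) (fun x => resource (π x)) ρ (fun x => e (π x)) :=
  h.comp π (by simp)

theorem decides_conflict
    (hp : Comp (fun x => encode (π x)) (fun x => resource (π x)) ρ p)
    (hq : Comp (fun x => encode (π x)) (fun x => resource (π x)) ρ q)
    (hd : Comp (fun x => encode (π x)) (fun x => resource (π x)) ρ d) :
    Decides (fun x => encode (π x)) (fun x => resource (π x)) ρ
      (fun x => (π x).Conflict (p x) (q x) (d x)) := by
  have hA := comp_base.pullback (π := π) (ρ := ρ)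
  have hg := comp_blocks.pullback (π := π) (ρ := ρ)
  have h0 := hd.mod hA
  have h1 := (hd.div hA).mod hA
  have h2 := (hd.div hA).div hA
  have hq1 := hq.div hg
  have hq2 := hq.mod hg
  refine ((Decides.eq hp hq1).and (Decides.eq h0 h1).not).or
    (((Decides.eq hp hq2).and (Decides.eq h0 h2).not).or ?_)
  exact (Decides.scan (bdd_length.comp π) (comp_blockLen.pullback) hp h0 hq1 h1 hq2 h2
    (comp_numVars.pullback) ((((Comp.const 2).mul (comp_size.pullback)).add (.const 1)).mul
      (.const 8))).congr fun x => clauses_iff (π x) _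

theorem decides_forbidden
    (hi : Comp (fun x => encode (π x)) (fun x => resource (π x)) ρ i)
    (hj : Comp (fun x => encode (π x)) (fun x => resource (π x)) ρ j)
    (hd : Comp (fun x => encode (π x)) (fun x => resource (π x)) ρ d) :
    Decides (fun x => encode (π x)) (fun x => resource (π x)) ρ
      (fun x => (π x).Forbidden (i x) (j x) (d x)) := by
  have hA := comp_base.pullback (π := π) (ρ := ρ)
  have hg := (Comp.const 2).add (comp_blocks.pullback (π := π) (ρ := ρ))
  have hs := comp_colors.pullback (π := π) (ρ := ρ)
  have hi0 := Decides.eq hi (.const 0)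
  have hgj := Decides.le hg hj
  exact (hi0.and ((Decides.eq hj (.const 1)).and (Decides.eq hd.succ hs).not)).or
    ((hi0.and ((Decides.le (.const 2) hj).and ((Decides.lt hj hg).and (Decides.le hA hd)))).or
    ((hi0.and (hgj.and (Decides.eq (hd.succ.mod hA) (.const 0)).not)).or
    ((Decides.le (.const 2) hi).and ((Decides.lt hi hg).and (hgj.and
      (decides_conflict (hi.sub (.const 2)) (hj.sub hg) hd))))))

theorem emits_edgeCode
    (hi : Comp (fun x => encode (π x)) (fun x => resource (π x)) ρ i)
    (hj : Comp (fun x => encode (π x)) (fun x => resource (π x)) ρ j) :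
    Emits (fun x => encode (π x)) (fun x => resource (π x)) ρ
      (fun x => (π x).edgeCode (i x) (j x)) := by
  classical
  refine (Emits.cond (.lt hi hj) (.cons true (.append (.loop
    (w := fun x d => if (π x).Forbidden (i x) (j x) d then true :: encodeNatBits d else [])
    comp_colors.pullback fun ρ' hρ hd => ?_) (.singleton false))) .nil).congr fun x => ?_
  · have hi' := hi.lift _ hρ
    have hj' := hj.lift _ hρ
    have h1 := decides_forbidden (π := fun x : Σ b, Fin (colors (π b).numVars) => π x.1) hi' hj' hd
    have h2 := Emits.encodeNatBits hd
    have h3 := h2.cons true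
    exact Emits.cond h1 h3 .nil
  · unfold edgeCode
    congr

theorem emits_row (hi : Comp (fun x => encode (π x)) (fun x => resource (π x)) ρ i) :
    Emits (fun x => encode (π x)) (fun x => resource (π x)) ρ
      (fun x => (List.range (vertices (π x).numVars)).flatMap ((π x).edgeCode (i x))) := by
  have hv := comp_vertices.pullback (ρ := ρ) (π := π)
  refine Emits.loop hv fun ρ' hρ hj => ?_
  exact emits_edgeCode (π := fun x : Σ b, Fin (vertices (π b).numVars) => π x.1) (hi.lift _ hρ) hj

end

theorem emits_encode_toColoring : Emits encode resource ∅ fun φ => φ.toColoring.encode := by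
  have h1 : Emits encode resource ∅ fun φ => encodeNatBits (vertices φ.numVars) :=
    .encodeNatBits comp_vertices
  have h2 : Emits encode resource ∅ fun φ => encodeNatBits (colors φ.numVars) :=
    .encodeNatBits comp_colors
  have h3 : Emits encode resource ∅ fun φ => (List.range (vertices φ.numVars)).flatMap fun i =>
      (List.range (vertices φ.numVars)).flatMap (φ.edgeCode i) :=
    .loop comp_vertices fun ρ' hρ hj =>
      emits_row (π := fun x : Σ φ : ThreeCNF, Fin (vertices φ.numVars) => x.1) hj
  exact ((h1.append h2).append h3).congr fun φ => (encode_toColoring φ).symm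

end ThreeCNF

/-! ### Correctness of the reduction -/

theorem blocks_pos (N : ℕ) : 0 < blocks N := Nat.succ_pos _

theorem blockLen_pos (N : ℕ) : 0 < blockLen N := Nat.succ_pos _

theorem base_pos (N : ℕ) : 0 < base N := by unfold base; positivity

theorem colors_eq (N : ℕ) : colors N = base N * base N * base N := by
  unfold colors base; ring

theorem div_blockLen_lt {N v : ℕ} (h : v < N) : v / blockLen N < blocks N := by
  rw [Nat.div_lt_iff_lt_mul (blockLen_pos N)]
  exact h.trans (Nat.lt_mul_div_succ N (blocks_pos N))

namespace ThreeCNF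

variable {φ : ThreeCNF}

/-- Two colors between 1 and s differ by less than s, so cutting the forbidden sets off at s loses
nothing. -/
theorem natAbs_sub_not_mem_t {u v : Fin (vertices φ.numVars)} (huv : u < v)
    (h : φ.toColoring.G.Adj u v) {x y : ℕ} (hx : 1 ≤ x ∧ x ≤ colors φ.numVars)
    (hy : 1 ≤ y ∧ y ≤ colors φ.numVars) :
    ((x : ℤ) - y).natAbs ∉ φ.toColoring.t ⟨s(u, v), h⟩ ↔
      ¬ φ.Forbidden u v ((x : ℤ) - y).natAbs := by
  classical
  rw [toColoring_t φ huv, Finset.mem_filter, Finset.mem_range, not_and]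
  exact ⟨fun h => h (by omega), fun h _ => h⟩

theorem t_swap {u v : Fin (vertices φ.numVars)} (h : φ.toColoring.G.Adj u v) :
    φ.toColoring.t ⟨s(u, v), h⟩ = φ.toColoring.t ⟨s(v, u), h.symm⟩ :=
  congrArg _ (Subtype.ext Sym2.eq_swap)

theorem positive_toColoring_iff : φ.toColoring.Positive ↔
    ∃ c : Fin (vertices φ.numVars) → ℕ, (∀ v, 1 ≤ c v ∧ c v ≤ colors φ.numVars) ∧
      ∀ u v : Fin (vertices φ.numVars), u < v →
        ¬ φ.Forbidden u v ((c u : ℤ) - c v).natAbs := by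
  constructor
  · rintro ⟨c, hc, h⟩
    have hc' : ∀ v : Fin (vertices φ.numVars), 1 ≤ c v ∧ c v ≤ colors φ.numVars :=
      fun v => Finset.mem_Icc.1 (hc v)
    exact ⟨c, hc', fun u v huv =>
      (natAbs_sub_not_mem_t huv huv.ne (hc' u) (hc' v)).1 (h u v huv.ne)⟩
  · rintro ⟨c, hc, h⟩
    have key : ∀ (u v : Fin (vertices φ.numVars)) (huv : φ.toColoring.G.Adj u v),
        ((c u : ℤ) - c v).natAbs ∉ φ.toColoring.t ⟨s(u, v), huv⟩ := fun u v huv => by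
      rcases lt_or_gt_of_ne (huv : u ≠ v) with hlt | hlt
      · exact (natAbs_sub_not_mem_t hlt huv (hc u) (hc v)).2 (h u v hlt)
      · rw [t_swap huv, ← Int.natAbs_neg, neg_sub]
        exact (natAbs_sub_not_mem_t hlt huv.symm (hc v) (hc u)).2 (h v u hlt)
    exact ⟨c, fun v => Finset.mem_Icc.2 (hc v), key⟩

/-- The assignment `τ` of the variables in the block `p`, as a number. -/
def blockValue {N : ℕ} (τ : Fin N → Bool) (p : ℕ) : ℕ :=
  Nat.ofBits fun o : Fin (blockLen N) =>
    if h : p * blockLen N + o < N then τ ⟨_, h⟩ else false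

theorem blockValue_lt {N : ℕ} (τ : Fin N → Bool) (p : ℕ) : blockValue τ p < base N :=
  Nat.ofBits_lt_two_pow _

theorem testBit_blockValue {N : ℕ} (τ : Fin N → Bool) (v : Fin N) :
    (blockValue τ (v / blockLen N)).testBit (v % blockLen N) = τ v := by
  rw [blockValue, Nat.testBit_ofBits_lt _ _ (Nat.mod_lt _ (blockLen_pos N))]
  have : (v : ℕ) / blockLen N * blockLen N + v % blockLen N = v := by
    rw [mul_comm]; exact Nat.div_add_mod _ _
  simp [this]

theorem positive_of_satisfiable (h : φ.Satisfiable) : φ.toColoring.Positive := by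
  rw [positive_toColoring_iff]
  set N := φ.numVars with hN
  set A := base N with hA
  set g := blocks N with hg
  have hA0 : 0 < A := base_pos N
  have hs : colors N = A * A * A := colors_eq N
  obtain ⟨τ, hτ⟩ := h
  let a := blockValue (N := N) τ
  have ha : ∀ p, a p < A := blockValue_lt τ
  let b : ℕ → ℕ := fun q => a (q / g) + A * a (q % g)
  have hb : ∀ q, (b q + 1) * A ≤ colors N := fun q => by
    have h1 := ha (q / g)
    have h2 : A * (a (q % g) + 1) ≤ A * A := Nat.mul_le_mul_left A (ha (q % g))
    rw [hs]
    refine Nat.mul_le_mul_right A ?_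
    simp only [b]
    rw [mul_add] at h2
    omega
  have hAs : A ≤ colors N := by
    have := hb 0; exact le_trans (by nlinarith [Nat.zero_le (b 0)]) this
  -- The digits of `b q` to the base A are the assignments of the blocks q / g and q % g; the shift
  -- by one in (b + 1)·A makes up for the block color A - a.
  let c : ℕ → ℕ := fun i => if i = 0 then 1 else if i = 1 then colors N else
    if i < 2 + g then A - a (i - 2) else (b (i - (2 + g)) + 1) * A
  have c0 : c 0 = 1 := rfl
  have c1 : c 1 = colors N := rfl
  have c2 : ∀ i, 2 ≤ i → i < 2 + g → c i = A - a (i - 2) := fun i h1 h2 => by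
    simp only [c]; rw [if_neg (by omega), if_neg (by omega), if_pos h2]
  have c3 : ∀ i, 2 + g ≤ i → c i = (b (i - (2 + g)) + 1) * A := fun i h1 => by
    simp only [c]; rw [if_neg (by omega), if_neg (by omega), if_neg (by omega)]
  refine ⟨fun i => c i, fun i => ?_, fun u v huv => ?_⟩
  · have h2 := ha (i - 2)
    have h3 := hb (i - (2 + g))
    have h4 : A ≤ (b (i - (2 + g)) + 1) * A := Nat.le_mul_of_pos_left _ (Nat.succ_pos _)
    simp only [c]
    split_ifs <;> omega
  · change ¬ φ.Forbidden u v ((c u : ℤ) - c v).natAbs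
    simp only [Forbidden, ← hN, ← hA, ← hg]
    rintro (⟨hu, hv, hd⟩ | ⟨hu, hv1, hv2, hd⟩ | ⟨hu, hv, hd⟩ | ⟨hu1, hu2, hv, hd⟩)
    · rw [hu, hv, c0, c1] at hd
      omega
    · rw [hu, c0, c2 v hv1 hv2] at hd
      have := ha (v - 2)
      omega
    · rw [hu, c0, c3 v hv] at hd
      apply hd
      have h4 : A ≤ (b (v - (2 + g)) + 1) * A := Nat.le_mul_of_pos_left _ (Nat.succ_pos _)
      rw [show ((1 : ℕ) - ((b (v - (2 + g)) + 1) * A : ℕ) : ℤ).natAbs + 1 =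
        (b (v - (2 + g)) + 1) * A by omega]
      exact Nat.mul_mod_left _ _
    · rw [c2 u hu1 hu2, c3 v hv] at hd
      set p := (u : ℕ) - 2
      set q := (v : ℕ) - (2 + g)
      have hap := ha p
      -- The central identity: (b + 1)A - (A - a) = a + A·b, so the distance shows all three block
      -- assignments as digits.
      have hd' : (((A - a p : ℕ) : ℤ) - ((b q + 1) * A : ℕ)).natAbs = a p + A * b q := by
        rw [add_mul, mul_comm A]; omega
      rw [hd'] at hd
      have e0 : (a p + A * b q) % A = a p := by
        rw [Nat.add_mul_mod_self_left, Nat.mod_eq_of_lt hap]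
      have e1 : (a p + A * b q) / A = b q := by
        rw [Nat.add_mul_div_left _ _ hA0, Nat.div_eq_of_lt hap, zero_add]
      have e2 : b q % A = a (q / g) := by
        rw [Nat.add_mul_mod_self_left, Nat.mod_eq_of_lt (ha _)]
      have e3 : b q / A = a (q % g) := by
        rw [Nat.add_mul_div_left _ _ hA0, Nat.div_eq_of_lt (ha _), zero_add]
      simp only [Conflict, ← hN, ← hA, ← hg, e0, e1, e2, e3] at hd
      rcases hd with ⟨h1, h2⟩ | ⟨h1, h2⟩ | ⟨C, hC, hF⟩
      · exact h2 (congrArg a h1)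
      · exact h2 (congrArg a h1)
      · obtain ⟨l, hl, hl'⟩ := hτ C hC
        have hnot : ∀ p, ¬ Falsified (blockLen N) p (a p) l.1 l.2 := by
          rintro _ ⟨rfl, h⟩
          exact h ((testBit_blockValue τ l.1).trans hl')
        rcases hF l hl with h | h | h <;> exact hnot _ h

theorem satisfiable_of_positive (h : φ.toColoring.Positive) : φ.Satisfiable := by
  rw [positive_toColoring_iff] at h
  set N := φ.numVars with hN
  set A := base N with hA
  set g := blocks N with hg
  have hA0 : 0 < A := base_pos N
  have hs : colors N = A * A * A := colors_eq N
  have hg0 : 0 < g := blocks_pos N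
  have hn : vertices N = 2 + g + g * g := rfl
  have h0 : 0 < vertices N := by omega
  have h1 : 1 < vertices N := by omega
  obtain ⟨c, hc, hF, hc0⟩ : ∃ c : Fin (vertices N) → ℕ, (∀ v, 1 ≤ c v ∧ c v ≤ colors N) ∧
      (∀ u v : Fin (vertices N), u < v →
        ¬ φ.Forbidden u v ((c u : ℤ) - c v).natAbs) ∧ c ⟨0, h0⟩ = 1 := by
    obtain ⟨c, hc, hF⟩ := h
    have h01 := hF ⟨0, h0⟩ ⟨1, h1⟩ (by simp [Fin.lt_def])
    have hd : ((c ⟨0, h0⟩ : ℤ) - c ⟨1, h1⟩).natAbs + 1 = colors N := by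
      by_contra hne
      exact h01 (.inl ⟨rfl, rfl, hne⟩)
    have hc0 := hc ⟨0, h0⟩
    have hc1 := hc ⟨1, h1⟩
    by_cases h : c ⟨0, h0⟩ = 1
    · exact ⟨c, hc, hF, h⟩
    -- Vertices 0 and 1 are at distance s - 1, so vertex 0 has color 1 or s. The reflection x ↦ s +
    -- 1 - x preserves all distances and exchanges the two cases.
    · refine ⟨fun v => colors N + 1 - c v, fun v => by have := hc v; dsimp only; omega, fun u v huv => ?_,
        by dsimp only; omega⟩
      have hu := hc u
      have hv := hc v
      rw [show (((colors N + 1 - c u : ℕ) : ℤ) - (colors N + 1 - c v : ℕ)).natAbs =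
        ((c u : ℤ) - c v).natAbs by omega]
      exact hF u v huv
  -- A distance below A from the color 1 means a color at most A, hence of the form A - a with a <
  -- A.
  have hrow : ∀ p (hp : p < g), c ⟨2 + p, by omega⟩ ≤ A := fun p hp => by
    have h1 := hc ⟨2 + p, by omega⟩
    have h2 := hF ⟨0, h0⟩ ⟨2 + p, by omega⟩ (by simp [Fin.lt_def])
    by_contra hne
    exact h2 (.inr (.inl ⟨rfl, by simp, by simpa using hp, by rw [hc0]; change A ≤ _; omega⟩))
  -- Since vertex 0 has color 1, the distance plus one is the color itself; it is a positive
  -- multiple of A.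
  have hcol : ∀ q (hq : q < g * g), ∃ b, c ⟨2 + g + q, by omega⟩ = (b + 1) * A := fun q hq => by
    have h1 := hc ⟨2 + g + q, by omega⟩
    have h2 := hF ⟨0, h0⟩ ⟨2 + g + q, by omega⟩ (by simp [Fin.lt_def])
    have h3 : c ⟨2 + g + q, by omega⟩ % A = 0 := by
      by_contra hne
      refine h2 (.inr (.inr (.inl ⟨rfl, by simp [← hN, ← hg], ?_⟩)))
      rw [hc0, show ((1 : ℕ) - (c ⟨2 + g + q, by omega⟩ : ℕ) : ℤ).natAbs + 1 =
        c ⟨2 + g + q, by omega⟩ by omega]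
      exact hne
    obtain ⟨k, hk⟩ := Nat.dvd_of_mod_eq_zero h3
    rcases k with _ | k
    · omega
    · exact ⟨k, by rw [hk, mul_comm]⟩
  choose! b hb using hcol
  let a : ℕ → ℕ := fun p => if hp : p < g then A - c ⟨2 + p, by omega⟩ else 0
  have ha : ∀ p, a p < A := fun p => by
    simp only [a]
    split_ifs with hp
    · have := hc ⟨2 + p, by omega⟩; omega
    · exact hA0
  have hno : ∀ p < g, ∀ q < g * g, ¬ φ.Conflict p q (a p + A * b q) := fun p hp q hq hcon => by
    refine hF ⟨2 + p, by omega⟩ ⟨2 + g + q, by omega⟩ (by simp [Fin.lt_def]; omega)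
      (.inr (.inr (.inr ⟨by simp, by simpa using hp, by simp [← hN, ← hg], ?_⟩)))
    have e : (((c ⟨2 + p, by omega⟩ : ℕ) : ℤ) - (c ⟨2 + g + q, by omega⟩ : ℕ)).natAbs =
        a p + A * b q := by
      have h1 := hrow p hp
      rw [hb q hq, add_mul, mul_comm A]
      simp only [a, dif_pos hp]
      omega
    rw [e]
    simpa [← hN, ← hg] using hcon
  have hcon : ∀ p < g, ∀ p₁ < g, ∀ p₂ < g, ¬ (
      (p = p₁ ∧ a p ≠ b (p₁ * g + p₂) % A) ∨ (p = p₂ ∧ a p ≠ b (p₁ * g + p₂) / A) ∨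
      ∃ C ∈ φ.clauses, ∀ l ∈ C, Falsified₃ (blockLen N) p (a p) p₁ (b (p₁ * g + p₂) % A) p₂
        (b (p₁ * g + p₂) / A) l.1 l.2) := by
    intro p hp p₁ hp₁ p₂ hp₂
    have hq : p₁ * g + p₂ < g * g := by nlinarith
    have h := hno p hp _ hq
    have e0 : (a p + A * b (p₁ * g + p₂)) % A = a p := by
      rw [Nat.add_mul_mod_self_left, Nat.mod_eq_of_lt (ha p)]
    have e1 : (a p + A * b (p₁ * g + p₂)) / A = b (p₁ * g + p₂) := by
      rw [Nat.add_mul_div_left _ _ hA0, Nat.div_eq_of_lt (ha p), zero_add]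
    have e2 : (p₁ * g + p₂) / g = p₁ := by
      rw [mul_comm, Nat.mul_add_div hg0, Nat.div_eq_of_lt hp₂, add_zero]
    have e3 : (p₁ * g + p₂) % g = p₂ := by
      rw [mul_comm, Nat.mul_add_mod, Nat.mod_eq_of_lt hp₂]
    simpa only [Conflict, ← hN, ← hA, ← hg, e0, e1, e2, e3] using h
  refine ⟨fun v => (a (v / blockLen N)).testBit (v % blockLen N), fun C hC => ?_⟩
  -- Clauses with fewer than three literals repeat a block. The empty clause may use block 0; it
  -- will be refuted by the constraint itself.
  obtain ⟨p, hp, p₁, hp₁, p₂, hp₂, hmem⟩ : ∃ p < g, ∃ p₁ < g, ∃ p₂ < g, ∀ l ∈ C,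
      (l.1 : ℕ) / blockLen N = p ∨ (l.1 : ℕ) / blockLen N = p₁ ∨ (l.1 : ℕ) / blockLen N = p₂ := by
    have hlt : ∀ l : Fin N × Bool, (l.1 : ℕ) / blockLen N < g := fun l => div_blockLen_lt l.1.2
    have hw := φ.width_le C hC
    match C, hw with
    | [], _ => exact ⟨0, hg0, 0, hg0, 0, hg0, by simp⟩
    | [l], _ => exact ⟨_, hlt l, _, hlt l, _, hlt l, by simp⟩
    | [l, m], _ => exact ⟨_, hlt l, _, hlt m, _, hlt m, by simp⟩
    | [l, m, k], _ => exact ⟨_, hlt l, _, hlt m, _, hlt k, by simp⟩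
  -- The pair vertex is compared with the vertices of its own two blocks, which forces its digits to
  -- agree with their assignments.
  have hb1 : a p₁ = b (p₁ * g + p₂) % A := by
    by_contra hne
    exact hcon p₁ hp₁ p₁ hp₁ p₂ hp₂ (.inl ⟨rfl, hne⟩)
  have hb2 : a p₂ = b (p₁ * g + p₂) / A := by
    by_contra hne
    exact hcon p₂ hp₂ p₁ hp₁ p₂ hp₂ (.inr (.inl ⟨rfl, hne⟩))
  have hC' : ¬ ∀ l ∈ C, Falsified₃ (blockLen N) p (a p) p₁ (a p₁) p₂ (a p₂) l.1 l.2 := by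
    rw [hb1, hb2]
    exact fun hall => hcon p hp p₁ hp₁ p₂ hp₂ (.inr (.inr ⟨C, hC, hall⟩))
  push Not at hC'
  obtain ⟨l, hl, hl'⟩ := hC'
  refine ⟨l, hl, ?_⟩
  by_contra hne
  rcases hmem l hl with h | h | h
  · exact hl' (.inl ⟨h, by rw [← h]; exact hne⟩)
  · exact hl' (.inr (.inl ⟨h, by rw [← h]; exact hne⟩))
  · exact hl' (.inr (.inr ⟨h, by rw [← h]; exact hne⟩))

theorem satisfiable_iff (φ : ThreeCNF) : φ.Satisfiable ↔ φ.toColoring.Positive :=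
  ⟨positive_of_satisfiable, satisfiable_of_positive⟩

end ThreeCNF

/-! ### The reduction in time -/

/-- A step lengthens a stack by at most one bit. Thus the running time bounds the length of the
output, and no separate estimate of the code length of the instance is needed. -/
theorem Prog.Exec.length_le {p : Prog} {s s' : ℕ → List Bool} {t : ℕ} (h : p.Exec s s' t) (k : ℕ) :
    (s' k).length ≤ (s k).length + t := by
  induction h with
  | skip s => omega
  | push j b s => by_cases h : k = j <;> simp [h]
  | pop j s =>
    by_cases h : k = j
    · subst h; simp; omega
    · simp [h]
  | seq _ _ ih ih' => omega
  | case _ ih => omega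
  | loop_nil _ => omega
  | loop_cons _ _ _ ih ih' => omega

/-- The input survives the emission and has to be erased before the solver takes over. -/
theorem Runs.clear_input (x o : List Bool) :
    Runs (.loop 0 (.pop 0)) (regs x o 0) (regs [] o 0) (x.length * 2 + 1) := by
  have := Runs.loop (p := .pop 0) (k := 0) (n := x.length) (T := 1)
    (fun i => regs (x.drop i) o 0) (by simp [regs]) (fun i hi => ⟨?_, ?_⟩)
  · simpa using this
  · simpa [regs] using hi
  · have h := Runs.pop 0 (regs (x.drop i) o 0)
    have e : Function.update (regs (x.drop i) o 0) 0 (regs (x.drop i) o 0 0).tail =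
        regs (x.drop (i + 1)) o 0 := by
      funext j
      rcases j with _ | _ | _ | j <;> simp [regs]
    rwa [e] at h

theorem regs_input (x : List Bool) : regs x [] 0 = Function.update (fun _ => []) 0 x := by
  funext j
  rcases j with _ | _ | _ | j <;> simp [regs]

theorem regs_output (o : List Bool) : regs [] o 0 = Function.update (fun _ => []) 2 o := by
  funext j
  rcases j with _ | _ | _ | j <;> simp [regs]

theorem Emits.exists_prog {α : Type} {inp w : α → List Bool} {S : α → ℕ} (h : Emits inp S ∅ w)
    (hl : Bdd S fun a => (inp a).length) :
    ∃ (p : Prog) (T : α → ℕ), Bdd S T ∧ ∀ a, Runs p (Function.update (fun _ => []) 0 (inp a))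
      (Function.update (fun _ => []) 2 (w a).reverse) (T a) := by
  obtain ⟨p, T, hT, hp⟩ := h 0 (fun _ f => f = 0) (by simp)
  refine ⟨.seq p (.loop 0 (.pop 0)), fun a => T a + ((inp a).length * 2 + 1) + 1,
    (hT.add ((hl.mul (.const 2)).add (.const 1))).add (.const 1), fun a => ?_⟩
  rw [← regs_input, ← regs_output]
  have := hp a 0 [] rfl (fun _ _ => rfl)
  rw [List.append_nil] at this
  exact this.seq (Runs.clear_input _ _)

theorem Bdd.eval {α : Type} {S e : α → ℕ} (h : Bdd S e) (p : Polynomial ℕ) :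
    Bdd S fun a => p.eval (e a) := by
  induction p using Polynomial.induction_on' with
  | add p q hp hq => simpa using hp.add hq
  | monomial n c =>
    simp only [Polynomial.eval_monomial]
    refine (Bdd.const c).mul ?_
    induction n with
    | zero => simpa using Bdd.const 1
    | succ n ih => simpa [pow_succ] using ih.mul h

theorem DecidableWithinTime.mono {α : Type} {enc : α → List Bool} {P : α → Prop} {T T' : α → ℝ}
    (h : DecidableWithinTime enc P T) (hT : ∀ a, T a ≤ T' a) : DecidableWithinTime enc P T' := by
  obtain ⟨M, hM⟩ := h
  refine ⟨M, fun a => ?_⟩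
  obtain ⟨b, m, hb, hm, ho⟩ := hM a
  exact ⟨b, m, hb, hm.trans (hT a), ho⟩

namespace ThreeCNF

/-- `X` collects the time of the reduction and of the transfer, `Y` the polynomial factor of the
solver on the constructed instance. -/
theorem decidableWithinTime_of_solvable {T : GenTColoring → ℝ}
    (h : GenTColoring.SolvableInTimeUpToPoly T) : ∃ X Y : ThreeCNF → ℕ, Bdd resource X ∧
      Bdd resource Y ∧
      DecidableWithinTime encode Satisfiable fun φ => X φ + T φ.toColoring * Y φ := by
  obtain ⟨q, hq⟩ := h
  obtain ⟨p, T', hT', hp⟩ := emits_encode_toColoring.exists_prog bdd_length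
  have hlen : Bdd resource fun φ => φ.toColoring.encode.length := hT'.mono fun φ => by
    obtain ⟨t, ht, he⟩ := hp φ
    have := he.length_le 2
    simp at this
    omega
  exact ⟨_, _, hT'.add (hlen.add (.const 1)), hlen.eval q,
    hq.of_reduction toColoring satisfiable_iff p T' hp⟩

theorem maxDist_toColoring (φ : ThreeCNF) : φ.toColoring.maxDist = colors φ.numVars - 1 := by
  classical
  have hg : 0 < blocks φ.numVars := blocks_pos _
  have hA : 0 < base φ.numVars := base_pos _
  have hs : base φ.numVars < colors φ.numVars :=
    Nat.pow_lt_pow_right one_lt_two (by have := blockLen_pos φ.numVars; omega)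
  refine le_antisymm (Finset.sup_le fun e _ => Finset.sup_le fun d hd => ?_) ?_
  · have : d < colors φ.numVars := Finset.mem_range.1 (Finset.mem_of_mem_filter d hd)
    exact Nat.le_sub_one_of_lt this
  -- The value s - 1 is attained between vertex 0 and the first block vertex, where all distances
  -- from A to s - 1 are forbidden.
  · let u : Fin (vertices φ.numVars) := ⟨0, by unfold vertices; omega⟩
    let v : Fin (vertices φ.numVars) := ⟨2, by unfold vertices; omega⟩
    have huv : u < v := by simp [u, v, Fin.lt_def]
    have h : φ.toColoring.G.Adj u v := huv.ne
    have hmem : colors φ.numVars - 1 ∈ φ.toColoring.t ⟨s(u, v), h⟩ := by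
      rw [toColoring_t φ huv, Finset.mem_filter, Finset.mem_range]
      exact ⟨by omega, .inr (.inl ⟨rfl, le_rfl, by simp only [v]; omega, by omega⟩)⟩
    refine le_trans ?_ (Finset.le_sup (Finset.mem_univ (⟨s(u, v), h⟩ : φ.toColoring.G.edgeSet)))
    exact Finset.le_sup (f := id) hmem

/-- This separates a factor polynomial in the length of the formula from a factor 2^o(N). -/
theorem resource_le (φ : ThreeCNF) : resource φ + 2 ≤
    (φ.encode.length + 1) * 2 ^ (φ.numVars.size + 1 + 3 * blockLen φ.numVars) := by
  have h1 : φ.numVars < 2 ^ φ.numVars.size := Nat.lt_size_self _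
  have h2 : 2 ≤ colors φ.numVars := by
    have := blockLen_pos φ.numVars
    calc 2 = 2 ^ 1 := rfl
      _ ≤ _ := Nat.pow_le_pow_right (by omega) (by omega)
  rw [pow_add]
  change φ.encode.length + φ.numVars + colors φ.numVars + 2 ≤ _ * (_ * colors φ.numVars)
  have h3 : φ.numVars + 2 ≤ 2 ^ (φ.numVars.size + 1) := by
    have := Nat.one_le_two_pow (n := φ.numVars.size)
    rw [pow_succ]; omega
  generalize 2 ^ (φ.numVars.size + 1) = x at h3 ⊢
  have h4 : x + colors φ.numVars ≤ x * colors φ.numVars := by nlinarith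
  nlinarith [Nat.zero_le (φ.encode.length * (x * colors φ.numVars - 1))]

end ThreeCNF

/-! ### Asymptotics -/

open Filter Asymptotics

theorem tendsto_blocks : Tendsto blocks atTop atTop := by
  refine tendsto_atTop.2 fun b => ?_
  filter_upwards [eventually_ge_atTop (2 ^ b)] with N hN
  exact (Nat.lt_size.2 hN).le.trans (Nat.le_succ _)

theorem two_pow_blocks_le {N : ℕ} (hN : N ≠ 0) : 2 ^ blocks N ≤ 4 * N := by
  have h : 0 < N.size := Nat.size_pos.2 (Nat.pos_of_ne_zero hN)
  have := Nat.lt_size.1 (show N.size - 1 < N.size by omega)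
  rw [blocks, show N.size + 1 = N.size - 1 + 2 by omega, pow_add]
  omega

theorem isBigO_two_pow_blocks :
    (fun N => (2 : ℝ) ^ blocks N) =O[atTop] fun N : ℕ => (N : ℝ) := by
  refine IsBigO.of_bound 4 ?_
  filter_upwards [eventually_ne_atTop 0] with N hN
  rw [Real.norm_of_nonneg (by positivity), Real.norm_of_nonneg (by positivity)]
  exact_mod_cast two_pow_blocks_le hN

/-- Since 2^g = O(N), every estimate can be made in terms of the number g of blocks. -/
theorem isLittleO_comp_blocks {F : ℕ → ℝ} (h : F =o[atTop] fun k : ℕ => (2 : ℝ) ^ k) :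
    (fun N => F (blocks N)) =o[atTop] fun N : ℕ => (N : ℝ) :=
  (h.comp_tendsto tendsto_blocks).trans_isBigO isBigO_two_pow_blocks

theorem isLittleO_pow_two_pow (m : ℕ) :
    (fun k : ℕ => (k : ℝ) ^ m) =o[atTop] fun k : ℕ => (2 : ℝ) ^ k :=
  isLittleO_pow_const_const_pow_of_one_lt m one_lt_two

theorem isLittleO_const_natCast (c : ℝ) : (fun _ => c) =o[atTop] fun N : ℕ => (N : ℝ) :=
  isLittleO_const_left.2 (.inr (tendsto_norm_atTop_atTop.comp tendsto_natCast_atTop_atTop))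

theorem isLittleO_size : (fun N : ℕ => (N.size : ℝ)) =o[atTop] fun N : ℕ => (N : ℝ) := by
  have h := isLittleO_comp_blocks (isLittleO_pow_two_pow 1)
  refine (h.sub (isLittleO_const_natCast 1)).congr_left fun N => ?_
  simp [blocks]

theorem blockLen_le (N : ℕ) : (blockLen N : ℝ) ≤ N / blocks N + 1 := by
  rw [blockLen, Nat.cast_add, Nat.cast_one]
  exact add_le_add_left Nat.cast_div_le 1

theorem le_blockLen (N : ℕ) : (N : ℝ) / blocks N ≤ blockLen N := by
  have h := Nat.lt_mul_div_succ N (blocks_pos N)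
  rw [div_le_iff₀ (by exact_mod_cast blocks_pos N), mul_comm]
  exact_mod_cast h.le

/-- The number of blocks tends to infinity; this is what makes the number of colors 2^o(N). -/
theorem isLittleO_blockLen :
    (fun N => (blockLen N : ℝ)) =o[atTop] fun N : ℕ => (N : ℝ) := by
  have h : (fun N : ℕ => (blocks N : ℝ)⁻¹ * N) =o[atTop] fun N : ℕ => 1 * (N : ℝ) :=
    ((isLittleO_one_iff ℝ).2 (tendsto_inv_atTop_zero.comp
      (tendsto_natCast_atTop_atTop.comp tendsto_blocks))).mul_isBigO (isBigO_refl _ _)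
  simp only [one_mul] at h
  refine (IsBigO.of_norm_le fun N => ?_).trans_isLittleO (h.add (isLittleO_const_natCast 1))
  rw [Real.norm_of_nonneg (by positivity), mul_comm, ← div_eq_mul_inv]
  exact blockLen_le N

theorem not_solvableInTimeUpToPoly (hETH : ExponentialTimeHypothesis) {T : GenTColoring → ℝ}
    {h : ℕ → ℝ} (hT : ∀ φ : ThreeCNF, T φ.toColoring ≤ (2 : ℝ) ^ h φ.numVars)
    (hh : h =o[atTop] fun N : ℕ => (N : ℝ)) : ¬ GenTColoring.SolvableInTimeUpToPoly T := by
  intro hS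
  obtain ⟨X, Y, hX, hY, hdec⟩ := ThreeCNF.decidableWithinTime_of_solvable hS
  obtain ⟨c, hc⟩ := hX.add hY
  -- The absolute value makes 2^|h| at least 1, so that the additive term `X` is absorbed as well.
  -- The exponent `c` comes from the polynomial bound of `X + Y` in `resource`.
  refine hETH ⟨fun N => |h N| + c * (N.size + 1 + 3 * blockLen N), (.X + 1) ^ c,
    hh.abs_left.add (((isLittleO_size.add (isLittleO_const_natCast 1)).add
      (isLittleO_blockLen.const_mul_left 3)).const_mul_left c), hdec.mono fun φ => ?_⟩
  have h1 : (1 : ℝ) ≤ 2 ^ |h φ.numVars| := Real.one_le_rpow one_le_two (abs_nonneg _)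
  have h2 : T φ.toColoring ≤ 2 ^ |h φ.numVars| :=
    (hT φ).trans (Real.rpow_le_rpow_of_exponent_le one_le_two (le_abs_self _))
  have h3 : X φ + Y φ ≤ ((φ.encode.length + 1) *
      2 ^ (φ.numVars.size + 1 + 3 * blockLen φ.numVars)) ^ c :=
    (hc φ).trans (Nat.pow_le_pow_left (ThreeCNF.resource_le φ) c)
  have h4 : (2 : ℝ) ^ (|h φ.numVars| + c * (φ.numVars.size + 1 + 3 * blockLen φ.numVars)) =
      2 ^ |h φ.numVars| * (2 ^ (φ.numVars.size + 1 + 3 * blockLen φ.numVars)) ^ c := by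
    rw [Real.rpow_add two_pos, ← pow_mul, ← Real.rpow_natCast 2 (_ * c)]
    push_cast
    rw [mul_comm (c : ℝ)]
  calc (X φ : ℝ) + T φ.toColoring * Y φ
      ≤ 2 ^ |h φ.numVars| * X φ + 2 ^ |h φ.numVars| * Y φ :=
        add_le_add (le_mul_of_one_le_left (Nat.cast_nonneg _) h1)
          (mul_le_mul_of_nonneg_right h2 (Nat.cast_nonneg _))
    _ = 2 ^ |h φ.numVars| * ((X φ + Y φ : ℕ) : ℝ) := by push_cast; ring
    _ ≤ 2 ^ |h φ.numVars| * ((((φ.encode.length + 1) *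
          2 ^ (φ.numVars.size + 1 + 3 * blockLen φ.numVars)) ^ c : ℕ) : ℝ) :=
        mul_le_mul_of_nonneg_left (by exact_mod_cast h3) (by positivity)
    _ = _ := by rw [h4]; simp [mul_pow]; ring

/-! ### The three time bounds in terms of the number of variables. -/

theorem vertices_le {k : ℕ} (hk : 2 ≤ k) : 2 + k + k * k ≤ 3 * (k * k) := by nlinarith

theorem isLittleO_two_rpow {f : ℕ → ℝ} (hf : f =o[atTop] fun n : ℕ => Real.sqrt n) :
    (fun k : ℕ => (2 : ℝ) ^ f (2 + k + k * k)) =o[atTop] fun k : ℕ => (2 : ℝ) ^ k := by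
  have ht : Tendsto (fun k : ℕ => 2 + k + k * k) atTop atTop :=
    tendsto_atTop_mono (fun k => show k ≤ _ by omega) tendsto_id
  have h1 : (fun k : ℕ => (2 : ℝ) ^ f (2 + k + k * k)) =O[atTop]
      fun k : ℕ => Real.sqrt 2 ^ k := by
    refine IsBigO.of_bound 1 ?_
    -- As √(2 + k + k²) ≤ 2k for k ≥ 2, the constant 1/4 gives an exponent at most k/2, and √2^k =
    -- o(2^k).
    filter_upwards [ht.eventually (hf.bound (show (0 : ℝ) < 1 / 4 by norm_num)),
      eventually_ge_atTop 2] with k hk hk2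
    rw [Real.norm_of_nonneg (by positivity), Real.norm_of_nonneg (by positivity), one_mul,
      Real.sqrt_eq_rpow, ← Real.rpow_natCast, ← Real.rpow_mul two_pos.le]
    refine Real.rpow_le_rpow_of_exponent_le one_le_two ?_
    rw [Real.norm_of_nonneg (Real.sqrt_nonneg _)] at hk
    have h2 : Real.sqrt ((2 + k + k * k : ℕ) : ℝ) ≤ 2 * k := by
      rw [Real.sqrt_le_left (by positivity)]
      have := vertices_le hk2
      have h3 : ((2 + k + k * k : ℕ) : ℝ) ≤ 3 * (k * k) := by exact_mod_cast this
      nlinarith [sq_nonneg (k : ℝ)]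
    have := (le_abs_self _).trans hk
    linarith
  refine h1.trans_isLittleO (isLittleO_pow_pow_of_lt_left (Real.sqrt_nonneg _) ?_)
  rw [Real.sqrt_lt' two_pos]; norm_num

/-- A crude bound suffices, because n is only of the order log² N. -/
theorem factorial_le_two_rpow (n : ℕ) : (n.factorial : ℝ) ≤ 2 ^ ((n : ℝ) ^ 2) := by
  have h : n.factorial ≤ 2 ^ (n ^ 2) :=
    n.factorial_le_pow.trans (by
      rw [sq, pow_mul]; exact Nat.pow_le_pow_left n.lt_two_pow_self.le n)
  have e : (2 : ℝ) ^ ((n : ℝ) ^ 2) = ((2 ^ (n ^ 2) : ℕ) : ℝ) := by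
    rw [← Nat.cast_pow, Real.rpow_natCast]; simp
  rw [e]
  exact_mod_cast h

theorem isLittleO_sq_two_pow :
    (fun k : ℕ => ((2 + k + k * k : ℕ) : ℝ) ^ 2) =o[atTop] fun k : ℕ => (2 : ℝ) ^ k := by
  refine IsBigO.trans_isLittleO (g := fun k : ℕ => (k : ℝ) ^ 4) (IsBigO.of_bound 9 ?_)
    (isLittleO_pow_two_pow 4)
  filter_upwards [eventually_ge_atTop 2] with k hk
  rw [Real.norm_of_nonneg (by positivity), Real.norm_of_nonneg (by positivity)]
  have h := Nat.pow_le_pow_left (vertices_le hk) 2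
  calc _ ≤ (((3 * (k * k)) ^ 2 : ℕ) : ℝ) := by exact_mod_cast h
    _ = _ := by push_cast; ring

/-- From w ≥ N/g and 2^g ≤ 4N follows log w ≥ (g - 2) log 2 - log g, which is at least g/4 once log
g ≤ g/8 and g ≥ 16. -/
theorem blocks_isBigO_log_blockLen :
    (fun N => (blocks N : ℝ)) =O[atTop] fun N : ℕ => Real.log (blockLen N) := by
  refine IsBigO.of_bound 4 ?_
  have h1 := (tendsto_natCast_atTop_atTop (R := ℝ)).comp tendsto_blocks
  filter_upwards [h1.eventually (Real.isLittleO_log_id_atTop.bound (show (0 : ℝ) < 1 / 8 by norm_num)),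
    h1.eventually_ge_atTop 16, eventually_ne_atTop 0] with N h2 h3 hN
  have hN' : (0 : ℝ) < N := by positivity
  simp only [Function.comp, id] at h2 h3
  have hg : (0 : ℝ) < blocks N := by linarith
  have h4 : Real.log (N / blocks N) ≤ Real.log (blockLen N) :=
    Real.log_le_log (by positivity) (le_blockLen N)
  rw [Real.log_div hN'.ne' hg.ne'] at h4
  have h5 : Real.log ((2 : ℝ) ^ blocks N) ≤ Real.log (4 * N) :=
    Real.log_le_log (by positivity) (by exact_mod_cast two_pow_blocks_le hN)
  rw [Real.log_pow, Real.log_mul (by norm_num) hN'.ne', show (4 : ℝ) = 2 ^ 2 by norm_num,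
    Real.log_pow] at h5
  have h6 := (le_abs_self _).trans h2
  rw [Real.norm_of_nonneg hg.le] at h6 ⊢
  refine le_trans ?_ (mul_le_mul_of_nonneg_left (le_abs_self _) (by norm_num))
  have h7 := Real.log_two_gt_d9
  push_cast at h5
  nlinarith

theorem log_colors (N : ℕ) : Real.log (colors N) = 3 * blockLen N * Real.log 2 := by
  rw [colors]; push_cast; rw [Real.log_pow]; push_cast; ring

theorem log_colors_sub_one_le (N : ℕ) : Real.log ((colors N - 1 : ℕ) : ℝ) ≤ 3 * blockLen N := by
  have h0 : 0 < colors N - 1 := by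
    have : 2 ^ 1 < colors N := Nat.pow_lt_pow_right one_lt_two (by have := blockLen_pos N; omega)
    omega
  calc _ ≤ Real.log (colors N) := Real.log_le_log (by exact_mod_cast h0) (by exact_mod_cast Nat.sub_le _ _)
    _ = 3 * blockLen N * Real.log 2 := log_colors N
    _ ≤ 3 * blockLen N * 1 := by
      refine mul_le_mul_of_nonneg_left ?_ (by positivity)
      linarith [Real.log_two_lt_d9]
    _ = _ := mul_one _

/-- s - 1 = 2^(3w) - 1 is at least 2^(2w), and 2 log 2 > 1. -/
theorem blockLen_le_log_colors_sub_one (N : ℕ) :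
    (blockLen N : ℝ) ≤ Real.log ((colors N - 1 : ℕ) : ℝ) := by
  have h : 2 ^ (2 * blockLen N) ≤ colors N - 1 :=
    Nat.le_sub_one_of_lt (Nat.pow_lt_pow_right one_lt_two (by have := blockLen_pos N; omega))
  have h1 : (0 : ℝ) ≤ blockLen N := by positivity
  calc (blockLen N : ℝ) ≤ 2 * blockLen N * Real.log 2 := by nlinarith [Real.log_two_gt_d9]
    _ = Real.log ((2 ^ (2 * blockLen N) : ℕ) : ℝ) := by
      push_cast; rw [Real.log_pow]; push_cast; ring
    _ ≤ _ := Real.log_le_log (by positivity) (by exact_mod_cast h)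

/-- With l = s - 1, the number of vertices is O(g²) and log log l is at least a constant times g, so
the factors g² cancel. For log l the weak bound O(N) is enough. -/
theorem isLittleO_vertices_mul {f : ℕ → ℝ} (hf : f =o[atTop]
    fun l : ℕ => Real.log (l : ℝ) / (Real.log (Real.log (l : ℝ))) ^ 2) :
    (fun N => (vertices N : ℝ) * f (colors N - 1)) =o[atTop] fun N : ℕ => (N : ℝ) := by
  have ht : Tendsto (fun N => (blockLen N : ℝ)) atTop atTop := by
    have h : (fun N => (blocks N : ℝ)) =O[atTop] fun N => (blockLen N : ℝ) :=
      blocks_isBigO_log_blockLen.trans (IsBigO.of_bound 1 (.of_forall fun N => by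
        have h0 : (1 : ℝ) ≤ blockLen N := by exact_mod_cast blockLen_pos N
        rw [Real.norm_of_nonneg (Real.log_nonneg h0), one_mul, Real.norm_of_nonneg (by linarith)]
        linarith [Real.log_le_sub_one_of_pos (show (0 : ℝ) < blockLen N by linarith)]))
    obtain ⟨c, hc, hb⟩ := h.exists_pos
    refine tendsto_atTop_mono' _ ?_ ((tendsto_natCast_atTop_atTop.comp
      tendsto_blocks).const_mul_atTop (inv_pos.2 hc))
    filter_upwards [hb.bound] with N hN
    simp only [Real.norm_natCast] at hN
    exact (inv_mul_le_iff₀ hc).2 hN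
  have ht' : Tendsto (fun N => colors N - 1) atTop atTop := by
    rw [← tendsto_natCast_atTop_iff (R := ℝ)]
    exact tendsto_atTop_mono (fun N => (blockLen_le_log_colors_sub_one N).trans
      (Real.log_le_self (Nat.cast_nonneg _))) ht
  have h1 : (fun N => (vertices N : ℝ)) =O[atTop] fun N => (blocks N : ℝ) ^ 2 := by
    refine IsBigO.of_bound 3 ?_
    filter_upwards [tendsto_blocks.eventually_ge_atTop 2] with N hN
    rw [Real.norm_of_nonneg (by positivity), Real.norm_of_nonneg (by positivity), sq]
    exact_mod_cast vertices_le hN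
  have h2 : (fun N => Real.log ((colors N - 1 : ℕ) : ℝ)) =O[atTop] fun N : ℕ => (N : ℝ) := by
    refine IsBigO.trans (IsBigO.of_bound 3 (.of_forall fun N => ?_)) isLittleO_blockLen.isBigO
    rw [Real.norm_of_nonneg ((Nat.cast_nonneg _).trans (blockLen_le_log_colors_sub_one N)),
      Real.norm_of_nonneg (by positivity)]
    exact log_colors_sub_one_le N
  have h3 : (fun N => (blocks N : ℝ)) =O[atTop]
      fun N => Real.log (Real.log ((colors N - 1 : ℕ) : ℝ)) := by
    refine blocks_isBigO_log_blockLen.trans (IsBigO.of_bound 1 ?_)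
    filter_upwards [ht.eventually_ge_atTop 1] with N hN
    have h : Real.log (blockLen N) ≤ Real.log (Real.log ((colors N - 1 : ℕ) : ℝ)) :=
      Real.log_le_log (by linarith) (blockLen_le_log_colors_sub_one N)
    have h0 := Real.log_nonneg hN
    rw [one_mul, Real.norm_of_nonneg h0, Real.norm_of_nonneg (h0.trans h)]
    exact h
  have h4 : (fun N => (Real.log (Real.log ((colors N - 1 : ℕ) : ℝ)) ^ 2)⁻¹) =O[atTop]
      fun N => ((blocks N : ℝ) ^ 2)⁻¹ :=
    (h3.pow 2).inv_rev (.of_forall fun N h => absurd h (by have := blocks_pos N; positivity))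
  have h5 := h1.mul_isLittleO ((hf.comp_tendsto ht').trans_isBigO (h2.mul h4))
  refine h5.congr_right fun N => ?_
  have := blocks_pos N
  field_simp

theorem mainTheorem8 (hETH : ExponentialTimeHypothesis) :
    (¬ ∃ f : ℕ → ℝ, f =o[Filter.atTop] (fun n : ℕ => Real.sqrt (n : ℝ)) ∧
      GenTColoring.SolvableInTimeUpToPoly
        (fun I => (2 : ℝ) ^ ((2 : ℝ) ^ f I.n))) ∧
    (¬ ∃ f : ℕ → ℝ,
      f =o[Filter.atTop]
        (fun l : ℕ => Real.log (l : ℝ) / (Real.log (Real.log (l : ℝ))) ^ 2) ∧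
      GenTColoring.SolvableInTimeUpToPoly
        (fun I => (2 : ℝ) ^ ((I.n : ℝ) * f I.maxDist))) ∧
    (¬ GenTColoring.SolvableInTimeUpToPoly (fun I => (Nat.factorial I.n : ℝ))) := by
  refine ⟨?_, ?_, ?_⟩
  · rintro ⟨f, hf, h⟩
    exact not_solvableInTimeUpToPoly hETH (h := fun N => 2 ^ f (vertices N)) (fun φ => le_rfl)
      (isLittleO_comp_blocks (isLittleO_two_rpow hf)) h
  · rintro ⟨f, hf, h⟩
    refine not_solvableInTimeUpToPoly hETH (fun φ => ?_) (isLittleO_vertices_mul hf) h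
    rw [ThreeCNF.maxDist_toColoring]
    exact le_rfl
  · exact not_solvableInTimeUpToPoly hETH (fun φ => factorial_le_two_rpow (vertices φ.numVars))
      (isLittleO_comp_blocks isLittleO_sq_two_pow)
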